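/- **Theorem 3.** For a real matrix $M$, let $\|M\|_{1\to 2}$ be the largest Euclidean norm of a column of $M$, let $\|M\|_{2\to\infty}$ be the largest Euclidean norm of a row of $M$ (each is $0$ if there are no columns, respectively rows), and let $\gamma_2(M)=\min\{\|L\|_{2\to\infty}\|R\|_{1\to 2} : LR=M\}$, the inner dimension being arbitrary. *Row arrival model.* The rows $q_1,q_2,\dots\in\mathbb{R}^N$ of a matrix arrive one at a time. A (deterministic) online factorization algorithm fixes an initial, possibly empty, matrix $R_0$ with $N$ columns. When $q_t$ arrives, it forms $R_t$ by adding (zero or more) rows to $R_{t-1}$ and outputs a row vector $\ell_t$ with $\ell_tR_t=q_t$; both may depend only on $q_1,\dots,q_t$ (and on $N$), in particular not on the total number of rows. It must always hold that $\|R_t\|_{1\to2}\le 1$. The algorithm achieves value $\gamma$ on an $m\times N$ matrix $Q$ with rows $q_1,\dots,q_m$ if $\|\ell_t\|_2\le\gamma$ for all $1\le t\le m$. *Column arrival model.* The columns $a_1,a_2,\dots\in\mathbb{R}^m$ of a matrix arrive one at a time. A (deterministic) online factorization algorithm fixes an initial, possibly empty, matrix $L_0$ with $m$ rows. When $a_t$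 arrives, it forms $L_t$ by adding (zero or more) columns to $L_{t-1}$ and outputs a column vector $r_t$ with $L_tr_t=a_t$ and $\|r_t\|_2\le1$; both may depend only on $a_1,\dots,a_t$ (and on $m$), in particular not on the total number of columns. The algorithm achieves value $\gamma$ on an $m\times N$ matrix $A$ with columns $a_1,\dots,a_N$ if $\|L_N\|_{2\to\infty}\le\gamma$. 1. For every $c>0$ there are a constant $K_c>0$, depending only on $c$, and an online factorization algorithm in the row arrival model such that, for all $m,N$ and every nonzero real $m\times N$ matrix $Q$ with rows $q_1,\dots,q_m$, the algorithm achieves value $$K_c\,\gamma_2(Q)\,\Bigl(1+\log\frac{\gamma_2(Q)}{\|q_s\|_\infty}\Bigr)^{\frac12+c}\,(1+\log N)^3,$$ where $q_s$ is the first nonzero row of $Q$ (so $s=1$ if $q_1\neq0$); on $Q=0$ it achieves value $0$. 2. There are an absolute constant $K>0$ and an online factorization algorithm in the column arrival model such that, for all $m,N$ and every real $m\times N$ matrix $A$, the algorithm achieves value $$K\,\gamma_2(A)\,(1+\log m)^3,$$ where $\log 0$ is read as $0$ if $m=0$. -/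

import Mathlib

noncomputable section

namespace OnlineFactorization

/-- The Euclidean norm of a finite real vector. -/
def l2norm {ι : Type*} [Fintype ι] (v : ι → ℝ) : ℝ :=
  ‖WithLp.toLp 2 v‖

/-- `‖R‖_{1→2}`: the largest Euclidean norm of a column of `R` (`0` if there are no columns). -/
def norm1to2 {k n : ℕ} (R : Matrix (Fin k) (Fin n) ℝ) : ℝ :=
  ⨆ j : Fin n, l2norm (fun i => R i j)

/-- `‖L‖_{2→∞}`: the largest Euclidean norm of a row of `L` (`0` if there are no rows). -/
def norm2toInf {m k : ℕ} (L : Matrix (Fin m) (Fin k) ℝ) : ℝ :=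
  ⨆ i : Fin m, l2norm (fun j => L i j)

/-- The factorization norm `γ₂(A)`: the least value of `‖L‖_{2→∞} ‖R‖_{1→2}` over all
factorizations `A = L R` through an arbitrary inner dimension `k`. -/
def gamma2 {m n : ℕ} (A : Matrix (Fin m) (Fin n) ℝ) : ℝ :=
  sInf {x : ℝ | ∃ (k : ℕ) (L : Matrix (Fin m) (Fin k) ℝ) (R : Matrix (Fin k) (Fin n) ℝ),
    L * R = A ∧ x = norm2toInf L * norm1to2 R}

/-- The first `t` rows of a matrix. -/
def firstRows {m n : ℕ} (Q : Matrix (Fin m) (Fin n) ℝ) (t : ℕ) (ht : t ≤ m) :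
    Matrix (Fin t) (Fin n) ℝ :=
  Q.submatrix (Fin.castLE ht) id

/-- The first `t` columns of a matrix. -/
def firstCols {m n : ℕ} (A : Matrix (Fin m) (Fin n) ℝ) (t : ℕ) (ht : t ≤ n) :
    Matrix (Fin m) (Fin t) ℝ :=
  A.submatrix id (Fin.castLE ht)

/-- A deterministic online factorization algorithm in the row arrival model, for rows in `ℝ^N`.

Everything the algorithm outputs at time `t` is a function of the matrix `Q_t` of the first `t`
rows only; the total number of rows is never part of the input.  The requirements hold for every
sequence of rows that may arrive. -/
structure RowArrivalAlgorithm (N : ℕ) where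
  /-- The number of rows of `R_t`, after the rows of `Q_t` have arrived. -/
  k : {t : ℕ} → Matrix (Fin t) (Fin N) ℝ → ℕ
  /-- The right matrix `R_t`; for `t = 0` this is the initial matrix `R_0`. -/
  R : {t : ℕ} → (Q : Matrix (Fin t) (Fin N) ℝ) → Matrix (Fin (k Q)) (Fin N) ℝ
  /-- The row vector `ℓ_{t+1}` that is output when row `t + 1` arrives. -/
  ell : {t : ℕ} → (Q : Matrix (Fin (t + 1)) (Fin N) ℝ) → Fin (k Q) → ℝ
  /-- Rows are only ever added to the right matrix. -/
  k_mono : ∀ {t : ℕ} (Q : Matrix (Fin (t + 1)) (Fin N) ℝ),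
    k (firstRows Q t t.le_succ) ≤ k Q
  /-- The rows that are already present in the right matrix never change. -/
  R_extends : ∀ {t : ℕ} (Q : Matrix (Fin (t + 1)) (Fin N) ℝ)
    (i : Fin (k (firstRows Q t t.le_succ))),
    R Q (Fin.castLE (k_mono Q) i) = R (firstRows Q t t.le_succ) i
  /-- `ℓ_t R_t = q_t`. -/
  ell_mul_R : ∀ {t : ℕ} (Q : Matrix (Fin (t + 1)) (Fin N) ℝ),
    Matrix.vecMul (ell Q) (R Q) = Q (Fin.last t)
  /-- `‖R_t‖_{1→2} ≤ 1`. -/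
  norm_R_le : ∀ {t : ℕ} (Q : Matrix (Fin t) (Fin N) ℝ), norm1to2 (R Q) ≤ 1

/-- The algorithm achieves factorization value `γ` on `Q`: `‖ℓ_t‖₂ ≤ γ` for `t = 1, …, m`. -/
def RowArrivalAlgorithm.AchievesValue {N m : ℕ} (alg : RowArrivalAlgorithm N)
    (Q : Matrix (Fin m) (Fin N) ℝ) (γ : ℝ) : Prop :=
  ∀ (t : ℕ) (ht : t + 1 ≤ m), l2norm (alg.ell (firstRows Q (t + 1) ht)) ≤ γ

/-- A deterministic online factorization algorithm in the column arrival model, for columns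
in `ℝ^m`.

Everything the algorithm outputs at time `t` is a function of the matrix `A_t` of the first `t`
columns only; the total number of columns is never part of the input.  The requirements hold for
every sequence of columns that may arrive. -/
structure ColumnArrivalAlgorithm (m : ℕ) where
  /-- The number of columns of `L_t`, after the columns of `A_t` have arrived. -/
  k : {t : ℕ} → Matrix (Fin m) (Fin t) ℝ → ℕ
  /-- The left matrix `L_t`; for `t = 0` this is the initial matrix `L_0`. -/
  L : {t : ℕ} → (A : Matrix (Fin m) (Fin t) ℝ) → Matrix (Fin m) (Fin (k A)) ℝ
  /-- The column vector `r_{t+1}` that is output when column `t + 1` arrives. -/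
  r : {t : ℕ} → (A : Matrix (Fin m) (Fin (t + 1)) ℝ) → Fin (k A) → ℝ
  /-- Columns are only ever added to the left matrix. -/
  k_mono : ∀ {t : ℕ} (A : Matrix (Fin m) (Fin (t + 1)) ℝ),
    k (firstCols A t t.le_succ) ≤ k A
  /-- The columns that are already present in the left matrix never change. -/
  L_extends : ∀ {t : ℕ} (A : Matrix (Fin m) (Fin (t + 1)) ℝ) (i : Fin m)
    (j : Fin (k (firstCols A t t.le_succ))),
    L A i (Fin.castLE (k_mono A) j) = L (firstCols A t t.le_succ) i j
  /-- `L_t r_t = a_t`. -/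
  L_mul_r : ∀ {t : ℕ} (A : Matrix (Fin m) (Fin (t + 1)) ℝ),
    Matrix.mulVec (L A) (r A) = fun i => A i (Fin.last t)
  /-- `‖r_t‖₂ ≤ 1` for every `t`, that is, `‖R_t‖_{1→2} ≤ 1`, where the columns of `R_t` are
  `r_1, …, r_t` padded with zeros. -/
  norm_r_le : ∀ {t : ℕ} (A : Matrix (Fin m) (Fin (t + 1)) ℝ), l2norm (r A) ≤ 1

/-- The algorithm achieves factorization value `γ` on `A`: the final left matrix satisfies
`‖L_N‖_{2→∞} ≤ γ`. -/
def ColumnArrivalAlgorithm.AchievesValue {m N : ℕ} (alg : ColumnArrivalAlgorithm m)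
    (A : Matrix (Fin m) (Fin N) ℝ) (γ : ℝ) : Prop :=
  norm2toInf (alg.L A) ≤ γ

end OnlineFactorization

end

/-!
An offline factorization `Q = L R` of value less than `g` yields a reference matrix
`X = 1 + Rᵀ R / ‖R‖²_{1→2}` with diagonal at most `2` and `(q / g)ᵀ X⁻¹ (q / g) ≤ 1` for all rows
`q` of `Q`. An online procedure that does not know `X` reaches the same covering guarantee with a
growing matrix `S`: as long as an arrival `a` has `aᵀ S⁻¹ a > 1`, a small multiple of `a aᵀ` is
added to `M`, and `S` grows by the resulting increase of the geometric mean of `M` and `P⁻¹`, where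
`P` is diagonal with entries exponential in the diagonal entries of `S`. The fidelity of `P` and
`M` increases by a fixed amount at each step. Its variational upper bound at multiples of `X`
limits both the number of steps and the growth of `P`, so the diagonal of `S` stays `O(1 + log n)`.

The unknown `g` is guessed by doubling, starting from the norm `β` of the first nonzero arrival; a
weighted sum of the covering matrices of all scales `2 ^ j * β` is factored as `Fᵀ F` by appending
square roots of its increments to `F`. In the row model the weights are summable, which keeps the
columns of `F` short and costs the factor `(1 + log (γ₂ / β)) ^ (1 / 2 + c)`. In the column model
the weights are the squared scales, whose sum is dominated by the largest one, and which make all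
coefficient vectors short. Since `S` enters through its square root, `√(1 + log n)` suffices in
place of `(1 + log n) ^ 3`.
-/

noncomputable section

namespace OnlineFactorization

open Matrix
open scoped MatrixOrder

section LoewnerOrder

variable {n : Type*}

instance : PosSMulMono ℝ (Matrix n n ℝ) where
  smul_le_smul_of_nonneg_left c hc A B h := by
    rw [Matrix.le_iff, ← smul_sub]
    exact (Matrix.le_iff.1 h).smul hc

theorem posDef_of_le {A B : Matrix n n ℝ} (hA : A.PosDef) (h : A ≤ B) : B.PosDef := by
  simpa only [add_sub_cancel] using hA.add_posSemidef (Matrix.le_iff.1 h)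

theorem diag_mono {A B : Matrix n n ℝ} (h : A ≤ B) (i : n) : A i i ≤ B i i :=
  sub_nonneg.1 (Matrix.le_iff.1 h).diag_nonneg

theorem posSemidef_vecMulVec_self [Finite n] (a : n → ℝ) : (vecMulVec a a).PosSemidef := by
  simpa only [star_trivial] using posSemidef_vecMulVec_self_star a

theorem le_add_smul_vecMulVec [Finite n] (M : Matrix n n ℝ) (a : n → ℝ) {w : ℝ} (hw : 0 ≤ w) :
    M ≤ M + w • vecMulVec a a := by
  rw [Matrix.le_iff, add_sub_cancel_left]
  exact (posSemidef_vecMulVec_self a).smul hw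

variable [Fintype n]

theorem quadForm_nonneg {A : Matrix n n ℝ} (hA : A.PosSemidef) (x : n → ℝ) :
    0 ≤ x ⬝ᵥ A *ᵥ x := by
  simpa only [star_trivial] using hA.dotProduct_mulVec_nonneg x

theorem quadForm_pos {A : Matrix n n ℝ} (hA : A.PosDef) {x : n → ℝ} (hx : x ≠ 0) :
    0 < x ⬝ᵥ A *ᵥ x := by
  simpa only [star_trivial] using hA.dotProduct_mulVec_pos hx

theorem quadForm_vecMulVec (a x : n → ℝ) : x ⬝ᵥ vecMulVec a a *ᵥ x = (a ⬝ᵥ x) ^ 2 := by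
  rw [vecMulVec_mulVec, op_smul_eq_smul, dotProduct_smul, smul_eq_mul, dotProduct_comm x a, sq]

theorem le_of_forall_quadForm_le {A B : Matrix n n ℝ} (hA : A.IsHermitian) (hB : B.IsHermitian)
    (h : ∀ x, x ⬝ᵥ A *ᵥ x ≤ x ⬝ᵥ B *ᵥ x) : A ≤ B :=
  .of_dotProduct_mulVec_nonneg (hB.sub hA) fun x => by
    rw [star_trivial, sub_mulVec, dotProduct_sub]
    exact sub_nonneg.2 (h x)

theorem quadForm_mono {A B : Matrix n n ℝ} (h : A ≤ B) (x : n → ℝ) :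
    x ⬝ᵥ A *ᵥ x ≤ x ⬝ᵥ B *ᵥ x := by
  have hsub := quadForm_nonneg (Matrix.le_iff.1 h) x
  rwa [sub_mulVec, dotProduct_sub, sub_nonneg] at hsub

theorem dotProduct_mulVec_comm {A : Matrix n n ℝ} (hA : A.IsHermitian) (x y : n → ℝ) :
    x ⬝ᵥ A *ᵥ y = y ⬝ᵥ A *ᵥ x := by
  have hAt : Aᵀ = A := by rw [← conjTranspose_eq_transpose_of_trivial, hA.eq]
  rw [dotProduct_mulVec, ← mulVec_transpose, hAt, dotProduct_comm]

theorem trace_vecMulVec_mul (a : n → ℝ) (B : Matrix n n ℝ) :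
    (vecMulVec a a * B).trace = a ⬝ᵥ B *ᵥ a := by
  rw [trace_mul_comm, mul_vecMulVec, trace_vecMulVec, dotProduct_comm]

theorem posDef_conj {A C : Matrix n n ℝ} (hA : A.PosDef) (hC : C.PosDef) :
    (C * A * C).PosDef := by
  classical
  simpa only [star_eq_conjTranspose, hC.isHermitian.eq] using
    (IsUnit.posDef_star_left_conjugate_iff hC.isUnit).2 hA

theorem trace_mul_nonneg {A B : Matrix n n ℝ} (hA : A.PosSemidef) (hB : B.PosSemidef) :
    0 ≤ (A * B).trace := by
  classical
  obtain ⟨C, rfl⟩ := CStarAlgebra.nonneg_iff_eq_star_mul_self.mp hA.nonneg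
  rw [star_eq_conjTranspose, Matrix.mul_assoc, trace_mul_comm]
  exact (hB.mul_mul_conjTranspose_same C).trace_nonneg

theorem trace_mul_mono {P A B : Matrix n n ℝ} (hP : P.PosSemidef) (h : A ≤ B) :
    (P * A).trace ≤ (P * B).trace := by
  have hsub := trace_mul_nonneg hP (Matrix.le_iff.1 h)
  rwa [Matrix.mul_sub, trace_sub, sub_nonneg] at hsub

theorem le_of_mul_self_le {A B : Matrix n n ℝ} (hA : A.PosSemidef) (hB : B.PosDef)
    (h : A * A ≤ B * B) : A ≤ B := by
  classical
  have hH : (B - A).IsHermitian := hB.isHermitian.sub hA.isHermitian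
  rw [Matrix.le_iff, hH.posSemidef_iff_eigenvalues_nonneg]
  intro i
  set v : n → ℝ := ⇑(hH.eigenvectorBasis i)
  set μ := hH.eigenvalues i
  have hv : v ≠ 0 := (WithLp.ofLp_eq_zero 2).not.2 (hH.eigenvectorBasis.orthonormal.ne_zero i)
  have eigen : (B - A) *ᵥ v = μ • v := hH.mulVec_eigenvectorBasis i
  have lyapunov : (2 : ℝ) • (B * B - A * A) = (B - A) * (A + B) + (A + B) * (B - A) := by
    rw [two_smul]
    noncomm_ring
  have quad_eq : v ⬝ᵥ (B * B - A * A) *ᵥ v = μ * (v ⬝ᵥ (A + B) *ᵥ v) := by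
    have hquad := congrArg (fun C => v ⬝ᵥ C *ᵥ v) lyapunov
    simp only [smul_mulVec, dotProduct_smul, add_mulVec (_ * _), dotProduct_add v (_ *ᵥ _),
      ← mulVec_mulVec, dotProduct_mulVec_comm hH v, eigen, mulVec_smul, smul_eq_mul,
      dotProduct_comm _ v] at hquad
    linarith
  have hnonneg : 0 ≤ v ⬝ᵥ (B * B - A * A) *ᵥ v := quadForm_nonneg (Matrix.le_iff.1 h) v
  exact nonneg_of_mul_nonneg_left (quad_eq ▸ hnonneg) (quadForm_pos (hB.posSemidef_add hA) hv)

variable [DecidableEq n]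

theorem isUnit_det_of_posDef {A : Matrix n n ℝ} (hA : A.PosDef) : IsUnit A.det :=
  (Matrix.isUnit_iff_isUnit_det A).1 hA.isUnit

theorem mul_inv_of_posDef {A : Matrix n n ℝ} (hA : A.PosDef) : A * A⁻¹ = 1 :=
  mul_nonsing_inv A (isUnit_det_of_posDef hA)

theorem inv_mul_of_posDef {A : Matrix n n ℝ} (hA : A.PosDef) : A⁻¹ * A = 1 :=
  nonsing_inv_mul A (isUnit_det_of_posDef hA)

theorem mulVec_inv_mulVec {A : Matrix n n ℝ} (hA : A.PosDef) (x : n → ℝ) :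
    A *ᵥ (A⁻¹ *ᵥ x) = x := by
  rw [mulVec_mulVec, mul_inv_of_posDef hA, one_mulVec]

theorem inv_smul_of_posDef {A : Matrix n n ℝ} (hA : A.PosDef) {c : ℝ} (hc : c ≠ 0) :
    (c • A)⁻¹ = c⁻¹ • A⁻¹ :=
  Matrix.inv_smul' A (Units.mk0 c hc) (isUnit_det_of_posDef hA)

theorem posDef_sqrt {A : Matrix n n ℝ} (hA : A.PosDef) : (CFC.sqrt A).PosDef :=
  (IsStrictlyPositive.sqrt A hA.isStrictlyPositive).posDef

theorem sqrt_mul_sqrt {A : Matrix n n ℝ} (hA : A.PosDef) : CFC.sqrt A * CFC.sqrt A = A :=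
  CFC.sqrt_mul_sqrt_self A hA.posSemidef.nonneg

theorem inv_quadForm_anti {A B : Matrix n n ℝ} (hA : A.PosDef) (h : A ≤ B) (q : n → ℝ) :
    q ⬝ᵥ B⁻¹ *ᵥ q ≤ q ⬝ᵥ A⁻¹ *ᵥ q := by
  set x := A⁻¹ *ᵥ q
  set y := B⁻¹ *ᵥ q
  have hAx : A *ᵥ x = q := mulVec_inv_mulVec hA q
  have hBy : B *ᵥ y = q := mulVec_inv_mulVec (posDef_of_le hA h) q
  have hAy : y ⬝ᵥ A *ᵥ y ≤ y ⬝ᵥ q := hBy ▸ quadForm_mono h y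
  have hxy := quadForm_nonneg hA.posSemidef (x - y)
  rw [mulVec_sub, dotProduct_sub, sub_dotProduct, sub_dotProduct,
    dotProduct_mulVec_comm hA.isHermitian x y, hAx] at hxy
  rw [dotProduct_comm q x, dotProduct_comm q y]
  linarith

theorem sq_dotProduct_le {S : Matrix n n ℝ} (hS : S.PosDef) (a x : n → ℝ) :
    (a ⬝ᵥ x) ^ 2 ≤ (a ⬝ᵥ S⁻¹ *ᵥ a) * (x ⬝ᵥ S *ᵥ x) := by
  have cauchySchwarz := (Matrix.toBilin' S).apply_mul_apply_le_of_forall_zero_le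
    (fun z => by simpa only [toBilin'_apply'] using quadForm_nonneg hS.posSemidef z)
    (S⁻¹ *ᵥ a) x
  simp only [toBilin'_apply'] at cauchySchwarz
  rwa [dotProduct_mulVec_comm hS.isHermitian (S⁻¹ *ᵥ a) x, mulVec_inv_mulVec hS,
    dotProduct_comm x a, dotProduct_comm (S⁻¹ *ᵥ a) a, ← sq] at cauchySchwarz

theorem vecMulVec_le_smul {S : Matrix n n ℝ} (hS : S.PosDef) (a : n → ℝ) :
    vecMulVec a a ≤ (a ⬝ᵥ S⁻¹ *ᵥ a) • S := by
  have hpos := quadForm_nonneg hS.inv.posSemidef a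
  refine le_of_forall_quadForm_le (posSemidef_vecMulVec_self a).isHermitian
    (hS.posSemidef.smul hpos).isHermitian fun x => ?_
  rw [quadForm_vecMulVec, smul_mulVec, dotProduct_smul, smul_eq_mul]
  exact sq_dotProduct_le hS a x

omit [DecidableEq n] in
theorem le_of_riccati_le {P G H : Matrix n n ℝ} (hP : P.PosDef) (hG : G.PosSemidef)
    (hH : H.PosDef) (h : G * P * G ≤ H * P * H) : G ≤ H := by
  classical
  set D := CFC.sqrt P
  have hD : D.PosDef := posDef_sqrt hP
  have hDD : D * D = P := sqrt_mul_sqrt hP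
  have conj_mul_conj (X : Matrix n n ℝ) : D * X * D * (D * X * D) = D * (X * P * X) * D := by
    rw [← hDD]
    noncomm_ring
  have unconj (X : Matrix n n ℝ) : D⁻¹ * (D * X * D) * D⁻¹ = X :=
    calc D⁻¹ * (D * X * D) * D⁻¹ = D⁻¹ * D * X * (D * D⁻¹) := by noncomm_ring
      _ = X := by
        rw [mul_inv_of_posDef hD, inv_mul_of_posDef hD, Matrix.one_mul, Matrix.mul_one]
  have hDG : (D * G * D).PosSemidef :=
    (IsSelfAdjoint.conjugate_nonneg hG.nonneg hD.isHermitian).posSemidef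
  have hconj : D * G * D ≤ D * H * D := by
    refine le_of_mul_self_le hDG (posDef_conj hH hD) ?_
    rw [conj_mul_conj, conj_mul_conj]
    exact IsSelfAdjoint.conjugate_le_conjugate h hD.isHermitian
  rw [← unconj G, ← unconj H]
  exact IsSelfAdjoint.conjugate_le_conjugate hconj hD.inv.isHermitian

end LoewnerOrder

section RiccatiSolution

variable {n : Type*} [Fintype n] [DecidableEq n]

/-- The geometric mean `P⁻¹ # M` of two positive definite matrices, that is, the positive definite
solution `G` of the Riccati equation `G P G = M`. It has no meaning unless `P` and `M` are positive
definite. -/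
def riccatiSolution (P M : Matrix n n ℝ) : Matrix n n ℝ :=
  (CFC.sqrt P)⁻¹ * CFC.sqrt (CFC.sqrt P * M * CFC.sqrt P) * (CFC.sqrt P)⁻¹

/-- The fidelity `tr (P G)` of positive definite matrices `P` and `M`, where `G` is the solution of
`G P G = M`; it equals `tr (P^{1/2} M P^{1/2})^{1/2}` and is the potential of the covering
procedure. -/
def fidelity (P M : Matrix n n ℝ) : ℝ :=
  (P * riccatiSolution P M).trace

variable {P P' M M' : Matrix n n ℝ}

theorem riccatiSolution_posDef (hP : P.PosDef) (hM : M.PosDef) :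
    (riccatiSolution P M).PosDef :=
  posDef_conj (posDef_sqrt (posDef_conj hM (posDef_sqrt hP))) (posDef_sqrt hP).inv

theorem riccatiSolution_equation (hP : P.PosDef) (hM : M.PosDef) :
    riccatiSolution P M * P * riccatiSolution P M = M := by
  set D := CFC.sqrt P
  have hD : D.PosDef := posDef_sqrt hP
  set T := CFC.sqrt (D * M * D)
  have hTT : T * T = D * M * D := sqrt_mul_sqrt (posDef_conj hM hD)
  have hDD : D * D = P := sqrt_mul_sqrt hP
  calc D⁻¹ * T * D⁻¹ * P * (D⁻¹ * T * D⁻¹)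
      = D⁻¹ * T * (D⁻¹ * D) * (D * D⁻¹) * T * D⁻¹ := by rw [← hDD]; noncomm_ring
    _ = D⁻¹ * (T * T) * D⁻¹ := by
        rw [mul_inv_of_posDef hD, inv_mul_of_posDef hD]; noncomm_ring
    _ = D⁻¹ * D * M * (D * D⁻¹) := by rw [hTT]; noncomm_ring
    _ = M := by rw [mul_inv_of_posDef hD, inv_mul_of_posDef hD, Matrix.one_mul, Matrix.mul_one]

theorem riccatiSolution_mono (hP : P.PosDef) (hM : M.PosDef) (h : M ≤ M') :
    riccatiSolution P M ≤ riccatiSolution P M' := by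
  have hM' := posDef_of_le hM h
  refine le_of_riccati_le hP (riccatiSolution_posDef hP hM).posSemidef
    (riccatiSolution_posDef hP hM') ?_
  rwa [riccatiSolution_equation hP hM, riccatiSolution_equation hP hM']

theorem riccatiSolution_anti (hP : P.PosDef) (hM : M.PosDef) (h : P ≤ P') :
    riccatiSolution P' M ≤ riccatiSolution P M := by
  have hP' := posDef_of_le hP h
  have hG' := riccatiSolution_posDef hP' hM
  refine le_of_riccati_le hP hG'.posSemidef (riccatiSolution_posDef hP hM) ?_
  calc riccatiSolution P' M * P * riccatiSolution P' M
      ≤ riccatiSolution P' M * P' * riccatiSolution P' M :=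
        IsSelfAdjoint.conjugate_le_conjugate h hG'.isHermitian
    _ = riccatiSolution P M * P * riccatiSolution P M := by
        rw [riccatiSolution_equation hP' hM, riccatiSolution_equation hP hM]

theorem riccatiSolution_one_one : riccatiSolution (1 : Matrix n n ℝ) 1 = 1 := by
  simp only [riccatiSolution, CFC.sqrt_one, Matrix.mul_one, inv_one]

theorem riccatiSolution_le_add_smul_inv (hP : P.PosDef) (hM : M.PosDef) {w s : ℝ} (hw : 0 ≤ w)
    (hs : 0 ≤ s) {a : n → ℝ} (hws : w * (a ⬝ᵥ P *ᵥ a) ≤ s ^ 2) :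
    riccatiSolution P (M + w • vecMulVec a a) ≤ riccatiSolution P M + s • P⁻¹ := by
  set G := riccatiSolution P M
  have hG : G.PosDef := riccatiSolution_posDef hP hM
  have hM' : (M + w • vecMulVec a a).PosDef := posDef_of_le hM (le_add_smul_vecMulVec M a hw)
  have hsP : (s • P⁻¹).PosSemidef := hP.inv.posSemidef.smul hs
  refine le_of_riccati_le hP (riccatiSolution_posDef hP hM').posSemidef
    (hG.add_posSemidef hsP) ?_
  have expand : (G + s • P⁻¹) * P * (G + s • P⁻¹) = M + (s ^ 2 • P⁻¹ + (2 * s) • G) := by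
    rw [← riccatiSolution_equation hP hM]
    simp only [add_mul, mul_add, Matrix.smul_mul, Matrix.mul_smul, Matrix.mul_assoc,
      inv_mul_of_posDef hP, mul_inv_of_posDef hP, Matrix.mul_one, Matrix.one_mul]
    module
  have rankOne : w • vecMulVec a a ≤ s ^ 2 • P⁻¹ :=
    calc w • vecMulVec a a ≤ w • (a ⬝ᵥ P *ᵥ a) • P⁻¹ := by
          gcongr
          simpa only [nonsing_inv_nonsing_inv P (isUnit_det_of_posDef hP)] using
            vecMulVec_le_smul hP.inv a
      _ ≤ s ^ 2 • P⁻¹ := by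
          rw [smul_smul, Matrix.le_iff, ← sub_smul]
          exact hP.inv.posSemidef.smul (sub_nonneg.2 hws)
  rw [riccatiSolution_equation hP hM', expand]
  gcongr
  refine rankOne.trans (le_add_of_nonneg_right ?_)
  exact (hG.posSemidef.smul (by positivity : 0 ≤ 2 * s)).nonneg

theorem trace_mul_inv_riccatiSolution (hP : P.PosDef) (hM : M.PosDef) :
    (M * (riccatiSolution P M)⁻¹).trace = fidelity P M := by
  have hG := riccatiSolution_posDef hP hM
  calc (M * (riccatiSolution P M)⁻¹).trace
      = (riccatiSolution P M * P * riccatiSolution P M * (riccatiSolution P M)⁻¹).trace := by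
        rw [riccatiSolution_equation hP hM]
    _ = fidelity P M := by
        rw [Matrix.mul_assoc, mul_inv_of_posDef hG, Matrix.mul_one, trace_mul_comm, fidelity]

theorem fidelity_nonneg (hP : P.PosDef) (hM : M.PosDef) : 0 ≤ fidelity P M :=
  trace_mul_nonneg hP.posSemidef (riccatiSolution_posDef hP hM).posSemidef

/-- Expand `0 ≤ tr (P (X - G) X⁻¹ (X - G))`; equality holds at `X = G`. -/
theorem two_mul_fidelity_le {X : Matrix n n ℝ} (hP : P.PosDef) (hM : M.PosDef)
    (hX : X.PosDef) : 2 * fidelity P M ≤ (P * X).trace + (M * X⁻¹).trace := by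
  set G := riccatiSolution P M
  have hG : G.IsHermitian := (riccatiSolution_posDef hP hM).isHermitian
  have hconj : ((X - G) * X⁻¹ * (X - G)).PosSemidef :=
    (IsSelfAdjoint.conjugate_nonneg hX.inv.posSemidef.nonneg (hX.isHermitian.sub hG)).posSemidef
  have expand : (X - G) * X⁻¹ * (X - G) = X - G - G + G * X⁻¹ * G :=
    calc (X - G) * X⁻¹ * (X - G)
        = X * X⁻¹ * X - X * X⁻¹ * G - G * (X⁻¹ * X) + G * X⁻¹ * G := by noncomm_ring
      _ = X - G - G + G * X⁻¹ * G := by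
        rw [mul_inv_of_posDef hX, inv_mul_of_posDef hX]
        simp only [Matrix.one_mul, Matrix.mul_one]
  have cyclic : (P * (G * X⁻¹ * G)).trace = (M * X⁻¹).trace :=
    calc (P * (G * X⁻¹ * G)).trace = (P * G * X⁻¹ * G).trace := by simp only [Matrix.mul_assoc]
      _ = (G * P * G * X⁻¹).trace := by rw [trace_mul_comm]; simp only [Matrix.mul_assoc]
      _ = (M * X⁻¹).trace := by rw [riccatiSolution_equation hP hM]
  have hnonneg := trace_mul_nonneg hP.posSemidef hconj
  rw [expand, Matrix.mul_add, Matrix.mul_sub, Matrix.mul_sub, trace_add, trace_sub, trace_sub,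
    cyclic] at hnonneg
  change 2 * (P * G).trace ≤ _
  linarith

theorem fidelity_mono_left (hP : P.PosDef) (hM : M.PosDef) (h : P ≤ P') :
    fidelity P M ≤ fidelity P' M := by
  have hP' := posDef_of_le hP h
  have hG' := riccatiSolution_posDef hP' hM
  have variational := two_mul_fidelity_le hP hM hG'
  rw [trace_mul_inv_riccatiSolution hP' hM] at variational
  have hle : (P * riccatiSolution P' M).trace ≤ fidelity P' M := by
    rw [fidelity, trace_mul_comm P, trace_mul_comm P']
    exact trace_mul_mono hG'.posSemidef h
  linarith

theorem two_mul_fidelity_add_le (hP : P.PosDef) (hM : M.PosDef) {w : ℝ} (hw : 0 ≤ w)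
    (a : n → ℝ) :
    2 * fidelity P M + w * (a ⬝ᵥ (riccatiSolution P (M + w • vecMulVec a a))⁻¹ *ᵥ a) ≤
      2 * fidelity P (M + w • vecMulVec a a) := by
  have hM' : (M + w • vecMulVec a a).PosDef := posDef_of_le hM (le_add_smul_vecMulVec M a hw)
  have variational := two_mul_fidelity_le hP hM (riccatiSolution_posDef hP hM')
  have split := trace_mul_inv_riccatiSolution hP hM'
  rw [Matrix.add_mul, Matrix.smul_mul, trace_add, trace_smul, trace_vecMulVec_mul,
    smul_eq_mul] at split
  change _ ≤ fidelity P (M + w • vecMulVec a a) + _ at variational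
  linarith

end RiccatiSolution

section CoveringProcedure

variable {n : Type*}

/-- The multiplicative weight that the covering procedure gives to coordinate `i` when its current
covering matrix is `S`. -/
def expWeight (S : Matrix n n ℝ) (i : n) : ℝ :=
  Real.exp ((S i i - 1) / 24)

theorem expWeight_pos (S : Matrix n n ℝ) (i : n) : 0 < expWeight S i := Real.exp_pos _

theorem one_le_expWeight {S : Matrix n n ℝ} {i : n} (hS : 1 ≤ S i i) : 1 ≤ expWeight S i :=
  Real.one_le_exp (by linarith)

theorem expWeight_le {S S' : Matrix n n ℝ} {i : n} (hle : S i i ≤ S' i i)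
    (hadd : S' i i ≤ S i i + 24) :
    expWeight S' i ≤ expWeight S i + expWeight S i * (S' i i - S i i) / 12 := by
  have hfactor : expWeight S' i = expWeight S i * Real.exp ((S' i i - S i i) / 24) := by
    rw [expWeight, expWeight, ← Real.exp_add]
    ring_nf
  have hexp : Real.exp ((S' i i - S i i) / 24) ≤ 1 + (S' i i - S i i) / 12 := by
    have habs := Real.abs_exp_sub_one_le (x := (S' i i - S i i) / 24)
      (abs_le.2 ⟨by linarith, by linarith⟩)
    rw [abs_of_nonneg (a := (S' i i - S i i) / 24) (by linarith)] at habs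
    linarith [le_of_abs_le habs]
  calc expWeight S' i = expWeight S i * Real.exp ((S' i i - S i i) / 24) := hfactor
    _ ≤ expWeight S i * (1 + (S' i i - S i i) / 12) :=
        mul_le_mul_of_nonneg_left hexp (expWeight_pos S i).le
    _ = expWeight S i + expWeight S i * (S' i i - S i i) / 12 := by ring

variable (n) in
/-- The weight that an arrival receives in a single step of the covering procedure. -/
def stepWeight [Fintype n] : ℝ := 1 / (16 * ((Fintype.card n : ℝ) + 1))

theorem stepWeight_pos [Fintype n] : 0 < stepWeight n := by
  rw [stepWeight]
  positivity

variable [DecidableEq n]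

/-- The diagonal matrix of the multiplicative weights of the coordinates. -/
def weightMatrix (S : Matrix n n ℝ) : Matrix n n ℝ :=
  diagonal (expWeight S)

theorem weightMatrix_posDef [Finite n] (S : Matrix n n ℝ) : (weightMatrix S).PosDef :=
  PosDef.diagonal (expWeight_pos S)

theorem weightMatrix_one : weightMatrix (1 : Matrix n n ℝ) = 1 := by
  rw [weightMatrix, ← diagonal_one]
  congr 1
  funext i
  rw [diagonal_one, expWeight, one_apply_eq, sub_self, zero_div, Real.exp_zero]

theorem weightMatrix_mono [Finite n] {S S' : Matrix n n ℝ} (h : S ≤ S') :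
    weightMatrix S ≤ weightMatrix S' := by
  rw [Matrix.le_iff, weightMatrix, weightMatrix, diagonal_sub, posSemidef_diagonal_iff]
  exact fun i => sub_nonneg.2 (Real.exp_le_exp.2 (by linarith [diag_mono h i]))

/-- An offline covering matrix against which the covering procedure is compared: it covers the
vectors `a` with `aᵀ X⁻¹ a ≤ 1`. -/
structure IsReference (X : Matrix n n ℝ) : Prop where
  one_le : 1 ≤ X
  diag_le : ∀ i, X i i ≤ 2

theorem IsReference.posDef [Finite n] {X : Matrix n n ℝ} (hX : IsReference X) : X.PosDef :=
  posDef_of_le .one hX.one_le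

variable [Fintype n]

theorem trace_weightMatrix_mul (S B : Matrix n n ℝ) :
    (weightMatrix S * B).trace = ∑ i, expWeight S i * B i i := by
  simp only [weightMatrix, trace, diag_apply, diagonal_mul]

theorem inv_weightMatrix_le_one {S : Matrix n n ℝ} (hS : 1 ≤ S) : (weightMatrix S)⁻¹ ≤ 1 := by
  have hinv : (weightMatrix S)⁻¹ = diagonal fun i => (expWeight S i)⁻¹ := by
    refine Matrix.inv_eq_right_inv ?_
    simp only [weightMatrix, diagonal_mul_diagonal, mul_inv_cancel₀ (expWeight_pos S _).ne',
      diagonal_one]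
  rw [hinv, Matrix.le_iff, ← diagonal_one, diagonal_sub, posSemidef_diagonal_iff]
  refine fun i => sub_nonneg.2 (inv_le_one_of_one_le₀ (one_le_expWeight ?_))
  simpa only [one_apply_eq] using diag_mono hS i

theorem IsReference.sq_apply_le {X : Matrix n n ℝ} (hX : IsReference X) {a : n → ℝ}
    (ha : a ⬝ᵥ X⁻¹ *ᵥ a ≤ 1) (i : n) : a i ^ 2 ≤ 2 := by
  have cauchySchwarz := sq_dotProduct_le hX.posDef a (Pi.single i 1)
  simp only [dotProduct_single, mul_one, mulVec_single_one, single_dotProduct, one_mul,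
    col_apply] at cauchySchwarz
  calc a i ^ 2 ≤ a ⬝ᵥ X⁻¹ *ᵥ a * X i i := cauchySchwarz
    _ ≤ 1 * X i i := mul_le_mul_of_nonneg_right ha hX.posDef.diag_pos.le
    _ ≤ 2 := by linarith [hX.diag_le i]

theorem IsReference.trace_inv_le {X : Matrix n n ℝ} (hX : IsReference X) :
    X⁻¹.trace ≤ Fintype.card n := by
  have hdiag (i : n) : X⁻¹ i i ≤ 1 := by
    have hanti := inv_quadForm_anti .one hX.one_le (Pi.single i 1)
    simpa only [inv_one, one_mulVec, mulVec_single_one, single_dotProduct, one_mul, col_apply,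
      one_apply_eq] using hanti
  calc X⁻¹.trace ≤ ∑ _i : n, (1 : ℝ) := Finset.sum_le_sum fun i _ => hdiag i
    _ = Fintype.card n := by rw [Finset.sum_const, Finset.card_univ, nsmul_one]

variable (n) in
/-- The state of the online covering procedure: the weighted sum `M` of the outer products of the
arrivals, and the current covering matrix `S`, which covers the vectors `a` with
`aᵀ S⁻¹ a ≤ 1`. -/
structure CoverState where
  M : Matrix n n ℝ
  S : Matrix n n ℝ

namespace CoverState

variable (n) in
/-- The state of the covering procedure before the first arrival. -/
def start : CoverState n := ⟨1, 1⟩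

/-- The geometric mean of the weighted arrivals and the inverse of the current weights. -/
def mean (st : CoverState n) : Matrix n n ℝ := riccatiSolution (weightMatrix st.S) st.M

/-- The fidelity of the current weights and the weighted arrivals: the potential function that
bounds both the number of steps and the growth of the weights. -/
def potential (st : CoverState n) : ℝ := fidelity (weightMatrix st.S) st.M

/-- The weighted arrivals after one more step of weight on `a`. -/
def nextM (a : n → ℝ) (st : CoverState n) : Matrix n n ℝ :=
  st.M + stepWeight n • vecMulVec a a

/-- The geometric mean of the weighted arrivals after one more step of weight on `a` with the
inverse of the weights before that step. -/
def nextMean (a : n → ℝ) (st : CoverState n) : Matrix n n ℝ :=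
  riccatiSolution (weightMatrix st.S) (st.nextM a)

/-- One step of weight on `a`; the covering matrix grows by the increase of the geometric mean. -/
def update (a : n → ℝ) (st : CoverState n) : CoverState n where
  M := st.nextM a
  S := st.S + (st.nextMean a - st.mean)

open Classical in
/-- One step of weight on `a` unless the covering matrix covers `a` already. -/
def step (a : n → ℝ) (st : CoverState n) : CoverState n :=
  if a ⬝ᵥ st.S⁻¹ *ᵥ a ≤ 1 then st else st.update a

variable (n) in
/-- A number of steps after which the potential would be too large if the arrival were still
uncovered. -/
def numSteps : ℕ := 600 * (Fintype.card n + 1) ^ 2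

/-- The reaction of the covering procedure to the arrival of `a`. -/
def absorb (a : n → ℝ) (st : CoverState n) : CoverState n :=
  (step a)^[numSteps n] st

/-- The invariant of the covering procedure with respect to the reference `X`. -/
structure Inv (X : Matrix n n ℝ) (st : CoverState n) : Prop where
  posDef_M : st.M.PosDef
  one_le_S : 1 ≤ st.S
  mean_le_S : st.mean ≤ st.S
  trace_le : (st.M * X⁻¹).trace ≤ 3 * st.potential
  sum_le : ∑ i, expWeight st.S i ≤ Fintype.card n + st.potential / 12

variable {X : Matrix n n ℝ} {st : CoverState n} {a : n → ℝ}

theorem inv_start (hX : IsReference X) : Inv X (start n) := by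
  have hmean : (start n).mean = 1 := by
    rw [mean, start, weightMatrix_one, riccatiSolution_one_one]
  have hpotential : (start n).potential = Fintype.card n := by
    rw [potential, fidelity, start, weightMatrix_one, riccatiSolution_one_one, Matrix.one_mul,
      trace_one]
  have hsum : ∑ i, expWeight (start n).S i = Fintype.card n := by
    rw [← hpotential, potential, fidelity, trace_weightMatrix_mul]
    refine Finset.sum_congr rfl fun i _ => ?_
    rw [start, weightMatrix_one, riccatiSolution_one_one, one_apply_eq, mul_one]
  refine ⟨.one, le_rfl, hmean.le, ?_, ?_⟩
  · rw [hpotential, start, Matrix.one_mul]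
    linarith [hX.trace_inv_le]
  · rw [hsum, hpotential]
    linarith

theorem Inv.posDef_S (h : Inv X st) : st.S.PosDef := posDef_of_le .one h.one_le_S

theorem Inv.one_le_expWeight (h : Inv X st) (i : n) : 1 ≤ expWeight st.S i :=
  OnlineFactorization.one_le_expWeight (by simpa only [one_apply_eq] using diag_mono h.one_le_S i)

theorem Inv.potential_le_sum (hX : IsReference X) (h : Inv X st) :
    st.potential ≤ 6 * ∑ i, expWeight st.S i := by
  have h3X : ((3 : ℝ) • X).PosDef := hX.posDef.smul (by norm_num)
  have variational := two_mul_fidelity_le (weightMatrix_posDef st.S) h.posDef_M h3X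
  have htrace : (weightMatrix st.S * (3 : ℝ) • X).trace ≤ 6 * ∑ i, expWeight st.S i := by
    rw [trace_weightMatrix_mul, Finset.mul_sum]
    refine Finset.sum_le_sum fun i _ => ?_
    rw [Matrix.smul_apply, smul_eq_mul]
    nlinarith [hX.diag_le i, expWeight_pos st.S i]
  rw [inv_smul_of_posDef hX.posDef three_ne_zero, Matrix.mul_smul st.M, trace_smul,
    smul_eq_mul] at variational
  change 2 * st.potential ≤ _ at variational
  linarith [h.trace_le]

theorem Inv.sum_le_two_mul_card (hX : IsReference X) (h : Inv X st) :
    ∑ i, expWeight st.S i ≤ 2 * Fintype.card n := by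
  linarith [h.potential_le_sum hX, h.sum_le]

theorem Inv.diag_S_le (hX : IsReference X) (h : Inv X st) (i : n) :
    st.S i i ≤ 24 * (1 + Real.log (Fintype.card n)) := by
  have hweight : expWeight st.S i ≤ 2 * Fintype.card n :=
    (Finset.single_le_sum (fun j _ => (expWeight_pos st.S j).le) (Finset.mem_univ i)).trans
      (h.sum_le_two_mul_card hX)
  have hcard : (0 : ℝ) < Fintype.card n := Nat.cast_pos.2 (Fintype.card_pos_iff.2 ⟨i⟩)
  have hlog := Real.log_le_log (expWeight_pos st.S i) hweight
  rw [expWeight, Real.log_exp, Real.log_mul two_ne_zero hcard.ne'] at hlog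
  linarith [Real.log_two_lt_d9]

omit [DecidableEq n] in
theorem posDef_nextM (hM : st.M.PosDef) (a : n → ℝ) : (st.nextM a).PosDef :=
  posDef_of_le hM (le_add_smul_vecMulVec st.M a stepWeight_pos.le)

theorem mean_le_nextMean (hM : st.M.PosDef) (a : n → ℝ) : st.mean ≤ st.nextMean a :=
  riccatiSolution_mono (weightMatrix_posDef st.S) hM
    (le_add_smul_vecMulVec st.M a stepWeight_pos.le)

theorem le_update_S (hM : st.M.PosDef) (a : n → ℝ) : st.S ≤ (st.update a).S :=
  le_add_of_nonneg_right (sub_nonneg.2 (mean_le_nextMean hM a))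

theorem nextMean_le_update_S (h : st.mean ≤ st.S) (a : n → ℝ) :
    st.nextMean a ≤ (st.update a).S :=
  calc st.nextMean a = st.mean + (st.nextMean a - st.mean) := (add_sub_cancel _ _).symm
    _ ≤ (st.update a).S := add_le_add_left h _

theorem Inv.stepWeight_mul_quadForm_le (hX : IsReference X) (ha : a ⬝ᵥ X⁻¹ *ᵥ a ≤ 1)
    (h : Inv X st) : stepWeight n * (a ⬝ᵥ weightMatrix st.S *ᵥ a) ≤ (1 / 2) ^ 2 := by
  have hquad : a ⬝ᵥ weightMatrix st.S *ᵥ a ≤ 4 * Fintype.card n :=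
    calc a ⬝ᵥ weightMatrix st.S *ᵥ a = ∑ i, expWeight st.S i * a i ^ 2 := by
          simp only [weightMatrix, dotProduct, mulVec_diagonal]
          exact Finset.sum_congr rfl fun i _ => by ring
      _ ≤ ∑ i, expWeight st.S i * 2 := Finset.sum_le_sum fun i _ =>
          mul_le_mul_of_nonneg_left (hX.sq_apply_le ha i) (expWeight_pos st.S i).le
      _ ≤ 4 * Fintype.card n := by
          rw [← Finset.sum_mul]
          linarith [h.sum_le_two_mul_card hX]
  rw [stepWeight, one_div, inv_mul_le_iff₀ (by positivity)]
  linarith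

theorem Inv.update_S_le (hX : IsReference X) (ha : a ⬝ᵥ X⁻¹ *ᵥ a ≤ 1) (h : Inv X st) :
    (st.update a).S ≤ st.S + (1 / 2 : ℝ) • 1 := by
  have hmean : st.nextMean a ≤ st.mean + (1 / 2 : ℝ) • 1 :=
    calc st.nextMean a ≤ st.mean + (1 / 2 : ℝ) • (weightMatrix st.S)⁻¹ :=
          riccatiSolution_le_add_smul_inv (weightMatrix_posDef st.S) h.posDef_M
            stepWeight_pos.le (by norm_num) (h.stepWeight_mul_quadForm_le hX ha)
      _ ≤ st.mean + (1 / 2 : ℝ) • 1 := by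
          gcongr
          exact inv_weightMatrix_le_one h.one_le_S
  exact add_le_add_right (sub_le_iff_le_add'.2 hmean) st.S

theorem Inv.quadForm_inv_le_nextMean (hX : IsReference X) (ha : a ⬝ᵥ X⁻¹ *ᵥ a ≤ 1)
    (h : Inv X st) : 2 / 3 * (a ⬝ᵥ st.S⁻¹ *ᵥ a) ≤ a ⬝ᵥ (st.nextMean a)⁻¹ *ᵥ a := by
  have hS : (st.update a).S ≤ (3 / 2 : ℝ) • st.S :=
    calc (st.update a).S ≤ st.S + (1 / 2 : ℝ) • 1 := h.update_S_le hX ha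
      _ ≤ st.S + (1 / 2 : ℝ) • st.S := by
          gcongr
          exact h.one_le_S
      _ = (3 / 2 : ℝ) • st.S := by module
  have hanti := inv_quadForm_anti
    (riccatiSolution_posDef (weightMatrix_posDef st.S) (posDef_nextM h.posDef_M a))
    ((nextMean_le_update_S h.mean_le_S a).trans hS) a
  rw [inv_smul_of_posDef h.posDef_S (by norm_num), smul_mulVec, dotProduct_smul, smul_eq_mul,
    inv_div] at hanti
  exact hanti

theorem Inv.potential_add_le_fidelity (hX : IsReference X) (ha : a ⬝ᵥ X⁻¹ *ᵥ a ≤ 1)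
    (hc : 1 < a ⬝ᵥ st.S⁻¹ *ᵥ a) (h : Inv X st) :
    st.potential + stepWeight n / 3 ≤ fidelity (weightMatrix st.S) (st.nextM a) := by
  have hincrease := two_mul_fidelity_add_le (weightMatrix_posDef st.S) h.posDef_M
    (stepWeight_pos (n := n)).le a
  have hcover : stepWeight n * (2 / 3) ≤ stepWeight n * (a ⬝ᵥ (st.nextMean a)⁻¹ *ᵥ a) :=
    mul_le_mul_of_nonneg_left (by linarith [h.quadForm_inv_le_nextMean hX ha])
      stepWeight_pos.le
  change 2 * st.potential + stepWeight n * (a ⬝ᵥ (st.nextMean a)⁻¹ *ᵥ a) ≤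
    2 * fidelity (weightMatrix st.S) (st.nextM a) at hincrease
  linarith

theorem fidelity_le_potential_update (hM : st.M.PosDef) (a : n → ℝ) :
    fidelity (weightMatrix st.S) (st.nextM a) ≤ (st.update a).potential :=
  fidelity_mono_left (weightMatrix_posDef st.S) (posDef_nextM hM a)
    (weightMatrix_mono (le_update_S hM a))

theorem Inv.potential_add_le_update (hX : IsReference X) (ha : a ⬝ᵥ X⁻¹ *ᵥ a ≤ 1)
    (hc : 1 < a ⬝ᵥ st.S⁻¹ *ᵥ a) (h : Inv X st) :
    st.potential + stepWeight n / 3 ≤ (st.update a).potential :=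
  (h.potential_add_le_fidelity hX ha hc).trans (fidelity_le_potential_update h.posDef_M a)

theorem Inv.sum_expWeight_update_le (hX : IsReference X) (ha : a ⬝ᵥ X⁻¹ *ᵥ a ≤ 1)
    (h : Inv X st) : ∑ i, expWeight (st.update a).S i ≤
      ∑ i, expWeight st.S i + ((st.update a).potential - st.potential) / 12 := by
  have hweight (i : n) : expWeight (st.update a).S i ≤
      expWeight st.S i + expWeight st.S i * (st.nextMean a - st.mean) i i / 12 := by
    have hadd := diag_mono (h.update_S_le hX ha) i
    rw [Matrix.add_apply, Matrix.smul_apply, one_apply_eq, smul_eq_mul] at hadd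
    have hle := expWeight_le (diag_mono (le_update_S h.posDef_M a) i) (by linarith)
    simpa only [update, Matrix.add_apply, add_sub_cancel_left] using hle
  have hsum : ∑ i, expWeight st.S i * (st.nextMean a - st.mean) i i =
      fidelity (weightMatrix st.S) (st.nextM a) - st.potential := by
    rw [← trace_weightMatrix_mul, Matrix.mul_sub, trace_sub]
    rfl
  calc ∑ i, expWeight (st.update a).S i
      ≤ ∑ i, expWeight st.S i +
          (∑ i, expWeight st.S i * (st.nextMean a - st.mean) i i) / 12 := by
        rw [Finset.sum_div, ← Finset.sum_add_distrib]
        exact Finset.sum_le_sum fun i _ => hweight i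
    _ ≤ _ := by
        rw [hsum]
        gcongr
        exact fidelity_le_potential_update h.posDef_M a

theorem Inv.update (hX : IsReference X) (ha : a ⬝ᵥ X⁻¹ *ᵥ a ≤ 1)
    (hc : 1 < a ⬝ᵥ st.S⁻¹ *ᵥ a) (h : Inv X st) : Inv X (st.update a) where
  posDef_M := posDef_nextM h.posDef_M a
  one_le_S := h.one_le_S.trans (le_update_S h.posDef_M a)
  mean_le_S :=
    (riccatiSolution_anti (weightMatrix_posDef st.S) (posDef_nextM h.posDef_M a)
      (weightMatrix_mono (le_update_S h.posDef_M a))).trans (nextMean_le_update_S h.mean_le_S a)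
  trace_le := by
    have htrace : ((st.update a).M * X⁻¹).trace =
        (st.M * X⁻¹).trace + stepWeight n * (a ⬝ᵥ X⁻¹ *ᵥ a) := by
      rw [CoverState.update, nextM, Matrix.add_mul, Matrix.smul_mul, trace_add, trace_smul,
        trace_vecMulVec_mul, smul_eq_mul]
    have hstep : stepWeight n * (a ⬝ᵥ X⁻¹ *ᵥ a) ≤ stepWeight n :=
      mul_le_of_le_one_right stepWeight_pos.le ha
    linarith [h.trace_le, h.potential_add_le_update hX ha hc]
  sum_le := by linarith [h.sum_le, h.sum_expWeight_update_le hX ha]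

theorem Inv.iterate_step (hX : IsReference X) (ha : a ⬝ᵥ X⁻¹ *ᵥ a ≤ 1) (h : Inv X st) (k : ℕ) :
    Inv X ((step a)^[k] st) ∧ st.S ≤ ((step a)^[k] st).S ∧
      (a ⬝ᵥ ((step a)^[k] st).S⁻¹ *ᵥ a ≤ 1 ∨
        k * (stepWeight n / 3) ≤ ((step a)^[k] st).potential) := by
  induction k with
  | zero =>
    refine ⟨h, le_rfl, .inr ?_⟩
    rw [Nat.cast_zero, zero_mul]
    exact fidelity_nonneg (weightMatrix_posDef st.S) h.posDef_M
  | succ k ih =>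
    obtain ⟨hinv, hS, hprogress⟩ := ih
    rw [Function.iterate_succ_apply', step]
    split_ifs with hc
    · exact ⟨hinv, hS, .inl hc⟩
    · refine ⟨hinv.update hX ha (not_le.1 hc), hS.trans (le_update_S hinv.posDef_M a), .inr ?_⟩
      have hpotential := hinv.potential_add_le_update hX ha (not_le.1 hc)
      push_cast
      linarith [hprogress.resolve_left hc]

theorem Inv.absorb (hX : IsReference X) (ha : a ⬝ᵥ X⁻¹ *ᵥ a ≤ 1) (h : Inv X st) :
    Inv X (st.absorb a) :=
  (h.iterate_step hX ha _).1

theorem Inv.le_absorb_S (hX : IsReference X) (ha : a ⬝ᵥ X⁻¹ *ᵥ a ≤ 1) (h : Inv X st) :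
    st.S ≤ (st.absorb a).S :=
  (h.iterate_step hX ha _).2.1

theorem Inv.absorb_covers (hX : IsReference X) (ha : a ⬝ᵥ X⁻¹ *ᵥ a ≤ 1) (h : Inv X st) :
    a ⬝ᵥ (st.absorb a).S⁻¹ *ᵥ a ≤ 1 := by
  obtain ⟨hinv, -, hprogress⟩ := h.iterate_step hX ha (numSteps n)
  refine hprogress.resolve_right fun hlarge => ?_
  have hpotential : ((step a)^[numSteps n] st).potential ≤ 12 * Fintype.card n := by
    linarith [hinv.potential_le_sum hX, hinv.sum_le_two_mul_card hX]
  have htotal : (numSteps n : ℝ) * (stepWeight n / 3) = 25 / 2 * (Fintype.card n + 1) := by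
    rw [stepWeight, numSteps]
    push_cast
    field_simp
    norm_num
  linarith [(Fintype.card n).cast_nonneg (α := ℝ)]

end CoverState

end CoveringProcedure

section FactorizationNorm

theorem l2norm_sq {ι : Type*} [Fintype ι] (v : ι → ℝ) : l2norm v ^ 2 = v ⬝ᵥ v := by
  rw [l2norm, EuclideanSpace.real_norm_sq_eq]
  simp only [dotProduct, sq]

theorem l2norm_nonneg {ι : Type*} [Fintype ι] (v : ι → ℝ) : 0 ≤ l2norm v := norm_nonneg _

theorem l2norm_le {ι : Type*} [Fintype ι] {v : ι → ℝ} {c : ℝ} (hc : 0 ≤ c)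
    (h : v ⬝ᵥ v ≤ c ^ 2) : l2norm v ≤ c :=
  le_of_sq_le_sq ((l2norm_sq v).trans_le h) hc

theorem sq_dotProduct_le_l2norm {ι : Type*} [Fintype ι] (u v : ι → ℝ) :
    (u ⬝ᵥ v) ^ 2 ≤ l2norm u ^ 2 * l2norm v ^ 2 := by
  simp only [l2norm_sq, dotProduct, ← sq]
  exact Finset.sum_mul_sq_le_sq_mul_sq _ _ _

theorem abs_dotProduct_le_l2norm {ι : Type*} [Fintype ι] (u v : ι → ℝ) :
    |u ⬝ᵥ v| ≤ l2norm u * l2norm v :=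
  abs_le_of_sq_le_sq (by simpa only [mul_pow] using sq_dotProduct_le_l2norm u v)
    (mul_nonneg (l2norm_nonneg u) (l2norm_nonneg v))

variable {m n k : ℕ}

theorem norm1to2_nonneg (R : Matrix (Fin k) (Fin n) ℝ) : 0 ≤ norm1to2 R :=
  Real.iSup_nonneg fun _ => l2norm_nonneg _

theorem norm2toInf_nonneg (L : Matrix (Fin m) (Fin k) ℝ) : 0 ≤ norm2toInf L :=
  Real.iSup_nonneg fun _ => l2norm_nonneg _

theorem norm1to2_transpose (L : Matrix (Fin m) (Fin k) ℝ) : norm1to2 Lᵀ = norm2toInf L := rfl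

theorem norm2toInf_transpose (R : Matrix (Fin k) (Fin n) ℝ) : norm2toInf Rᵀ = norm1to2 R := rfl

theorem l2norm_col_le (R : Matrix (Fin k) (Fin n) ℝ) (j : Fin n) :
    l2norm (fun i => R i j) ≤ norm1to2 R :=
  le_ciSup (f := fun j => l2norm (fun i => R i j)) (Set.finite_range _).bddAbove j

theorem l2norm_row_le (L : Matrix (Fin m) (Fin k) ℝ) (i : Fin m) :
    l2norm (L i) ≤ norm2toInf L :=
  l2norm_col_le Lᵀ i

theorem norm1to2_le {R : Matrix (Fin k) (Fin n) ℝ} {c : ℝ} (hc : 0 ≤ c)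
    (h : ∀ j, (Rᵀ * R) j j ≤ c ^ 2) : norm1to2 R ≤ c :=
  Real.iSup_le (fun j => l2norm_le hc (h j)) hc

theorem norm2toInf_firstRows_le (L : Matrix (Fin m) (Fin k) ℝ) (t : ℕ) (ht : t ≤ m) :
    norm2toInf (firstRows L t ht) ≤ norm2toInf L :=
  Real.iSup_le (fun i => l2norm_row_le L (Fin.castLE ht i)) (norm2toInf_nonneg L)

theorem gamma2_nonneg (A : Matrix (Fin m) (Fin n) ℝ) : 0 ≤ gamma2 A := by
  refine Real.sInf_nonneg ?_
  rintro x ⟨k, L, R, -, rfl⟩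
  exact mul_nonneg (norm2toInf_nonneg L) (norm1to2_nonneg R)

theorem gamma2_mul_le (L : Matrix (Fin m) (Fin k) ℝ) (R : Matrix (Fin k) (Fin n) ℝ) :
    gamma2 (L * R) ≤ norm2toInf L * norm1to2 R := by
  refine csInf_le ⟨0, ?_⟩ ⟨k, L, R, rfl, rfl⟩
  rintro x ⟨k, L, R, -, rfl⟩
  exact mul_nonneg (norm2toInf_nonneg L) (norm1to2_nonneg R)

theorem le_gamma2 {A : Matrix (Fin m) (Fin n) ℝ} {c : ℝ}
    (h : ∀ (k : ℕ) (L : Matrix (Fin m) (Fin k) ℝ) (R : Matrix (Fin k) (Fin n) ℝ), L * R = A →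
      c ≤ norm2toInf L * norm1to2 R) : c ≤ gamma2 A := by
  refine le_csInf ⟨_, n, A, 1, Matrix.mul_one A, rfl⟩ ?_
  rintro x ⟨k, L, R, hLR, rfl⟩
  exact h k L R hLR

theorem exists_factorization_lt {A : Matrix (Fin m) (Fin n) ℝ} {g : ℝ} (h : gamma2 A < g) :
    ∃ (k : ℕ) (L : Matrix (Fin m) (Fin k) ℝ) (R : Matrix (Fin k) (Fin n) ℝ), L * R = A ∧
      norm2toInf L * norm1to2 R < g := by
  by_contra! hle
  exact h.not_ge (le_gamma2 hle)

theorem abs_apply_le_gamma2 (A : Matrix (Fin m) (Fin n) ℝ) (i : Fin m) (j : Fin n) :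
    |A i j| ≤ gamma2 A := by
  refine le_gamma2 fun k L R hLR => ?_
  calc |A i j| = |L i ⬝ᵥ fun l => R l j| := by rw [← hLR]; rfl
    _ ≤ l2norm (L i) * l2norm (fun l => R l j) := abs_dotProduct_le_l2norm _ _
    _ ≤ norm2toInf L * norm1to2 R :=
        mul_le_mul (l2norm_row_le L i) (l2norm_col_le R j) (l2norm_nonneg _) (norm2toInf_nonneg L)

theorem norm_row_le_gamma2 (A : Matrix (Fin m) (Fin n) ℝ) (i : Fin m) : ‖A i‖ ≤ gamma2 A :=
  (pi_norm_le_iff_of_nonneg (gamma2_nonneg A)).2 (abs_apply_le_gamma2 A i)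

theorem gamma2_transpose_le (A : Matrix (Fin m) (Fin n) ℝ) : gamma2 Aᵀ ≤ gamma2 A := by
  refine le_gamma2 fun k L R hLR => ?_
  rw [← hLR, transpose_mul, mul_comm, ← norm1to2_transpose, ← norm2toInf_transpose]
  exact gamma2_mul_le Rᵀ Lᵀ

theorem gamma2_transpose (A : Matrix (Fin m) (Fin n) ℝ) : gamma2 Aᵀ = gamma2 A :=
  (gamma2_transpose_le A).antisymm (gamma2_transpose_le Aᵀ)

theorem gamma2_firstRows_le (Q : Matrix (Fin m) (Fin n) ℝ) (t : ℕ) (ht : t ≤ m) :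
    gamma2 (firstRows Q t ht) ≤ gamma2 Q := by
  refine le_gamma2 fun k L R hLR => ?_
  calc gamma2 (firstRows Q t ht) = gamma2 (firstRows L t ht * R) := by rw [← hLR]; rfl
    _ ≤ norm2toInf (firstRows L t ht) * norm1to2 R := gamma2_mul_le _ _
    _ ≤ norm2toInf L * norm1to2 R :=
        mul_le_mul_of_nonneg_right (norm2toInf_firstRows_le L t ht) (norm1to2_nonneg R)

end FactorizationNorm

section FactorReference

variable {m n k : ℕ}

/-- The reference obtained from the right factor `R` of an offline factorization, with the columns
of `R` rescaled to length at most `1` (for `R = 0` the inverse in front of `Rᵀ R` is `0`). -/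
def factorReference (R : Matrix (Fin k) (Fin n) ℝ) : Matrix (Fin n) (Fin n) ℝ :=
  1 + (norm1to2 R ^ 2)⁻¹ • (Rᵀ * R)

theorem posSemidef_transpose_mul_self (R : Matrix (Fin k) (Fin n) ℝ) : (Rᵀ * R).PosSemidef := by
  simpa only [conjTranspose_eq_transpose_of_trivial] using posSemidef_conjTranspose_mul_self R

theorem transpose_mul_self_apply_le (R : Matrix (Fin k) (Fin n) ℝ) (j : Fin n) :
    (Rᵀ * R) j j ≤ norm1to2 R ^ 2 :=
  calc (Rᵀ * R) j j = l2norm (fun i => R i j) ^ 2 := (l2norm_sq _).symm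
    _ ≤ norm1to2 R ^ 2 := pow_le_pow_left₀ (l2norm_nonneg _) (l2norm_col_le R j) 2

theorem isReference_factorReference (R : Matrix (Fin k) (Fin n) ℝ) :
    IsReference (factorReference R) where
  one_le := by
    rw [factorReference, Matrix.le_iff, add_sub_cancel_left]
    exact (posSemidef_transpose_mul_self R).smul (inv_nonneg.2 (sq_nonneg _))
  diag_le j := by
    have hle : (norm1to2 R ^ 2)⁻¹ * (Rᵀ * R) j j ≤ 1 :=
      inv_mul_le_one_of_le₀ (transpose_mul_self_apply_le R j) (sq_nonneg _)
    rw [factorReference, Matrix.add_apply, one_apply_eq, Matrix.smul_apply, smul_eq_mul]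
    linarith

theorem eq_zero_of_norm1to2_eq_zero {R : Matrix (Fin k) (Fin n) ℝ} (h : norm1to2 R = 0) :
    R = 0 := by
  ext i j
  have hcol : l2norm (fun i => R i j) = 0 :=
    le_antisymm ((l2norm_col_le R j).trans h.le) (l2norm_nonneg _)
  have hself := l2norm_sq fun i => R i j
  rw [hcol, zero_pow two_ne_zero, eq_comm, dotProduct_self_eq_zero] at hself
  exact congrFun hself i

theorem transpose_mul_self_le_factorReference (R : Matrix (Fin k) (Fin n) ℝ) :
    Rᵀ * R ≤ norm1to2 R ^ 2 • factorReference R := by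
  by_cases hR : norm1to2 R = 0
  · rw [eq_zero_of_norm1to2_eq_zero hR, Matrix.mul_zero, factorReference, Matrix.mul_zero,
      smul_zero, add_zero, Matrix.le_iff, sub_zero]
    exact PosSemidef.one.smul (sq_nonneg _)
  · rw [factorReference, smul_add, smul_inv_smul₀ (pow_ne_zero 2 hR), Matrix.le_iff,
      add_sub_cancel_right]
    exact PosSemidef.one.smul (sq_nonneg _)

theorem factorReference_covers (L : Matrix (Fin m) (Fin k) ℝ) (R : Matrix (Fin k) (Fin n) ℝ)
    (i : Fin m) : (L * R) i ⬝ᵥ (factorReference R)⁻¹ *ᵥ (L * R) i ≤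
      (norm2toInf L * norm1to2 R) ^ 2 := by
  set X := factorReference R
  have hX : X.PosDef := (isReference_factorReference R).posDef
  set q := (L * R) i
  set y := X⁻¹ *ᵥ q with hy
  have hqy : q ⬝ᵥ y = L i ⬝ᵥ R *ᵥ y := (dotProduct_mulVec (L i) R y).symm
  have hRy : l2norm (R *ᵥ y) ^ 2 ≤ norm1to2 R ^ 2 * (q ⬝ᵥ y) :=
    calc l2norm (R *ᵥ y) ^ 2 = y ⬝ᵥ (Rᵀ * R) *ᵥ y := by
          rw [l2norm_sq, ← mulVec_mulVec, dotProduct_mulVec y, vecMul_transpose]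
      _ ≤ y ⬝ᵥ (norm1to2 R ^ 2 • X) *ᵥ y :=
          quadForm_mono (transpose_mul_self_le_factorReference R) y
      _ = norm1to2 R ^ 2 * (q ⬝ᵥ y) := by
          rw [smul_mulVec, dotProduct_smul, smul_eq_mul, hy, mulVec_inv_mulVec hX,
            dotProduct_comm q]
  have hnonneg : 0 ≤ q ⬝ᵥ y := quadForm_nonneg hX.inv.posSemidef q
  have hsq : (q ⬝ᵥ y) * (q ⬝ᵥ y) ≤ (norm2toInf L * norm1to2 R) ^ 2 * (q ⬝ᵥ y) :=
    calc (q ⬝ᵥ y) * (q ⬝ᵥ y) = (L i ⬝ᵥ R *ᵥ y) ^ 2 := by rw [hqy, sq]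
      _ ≤ l2norm (L i) ^ 2 * l2norm (R *ᵥ y) ^ 2 := sq_dotProduct_le_l2norm _ _
      _ ≤ norm2toInf L ^ 2 * (norm1to2 R ^ 2 * (q ⬝ᵥ y)) :=
          mul_le_mul (pow_le_pow_left₀ (l2norm_nonneg _) (l2norm_row_le L i) 2) hRy
            (sq_nonneg _) (sq_nonneg _)
      _ = (norm2toInf L * norm1to2 R) ^ 2 * (q ⬝ᵥ y) := by ring
  rcases hnonneg.eq_or_lt with hzero | hpos
  · rw [← hzero]
    positivity
  · exact le_of_mul_le_mul_right hsq hpos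

theorem quadForm_inv_smul_le_one_iff {g : ℝ} (hg : 0 < g) (B : Matrix (Fin n) (Fin n) ℝ)
    (q : Fin n → ℝ) : (g⁻¹ • q) ⬝ᵥ B *ᵥ (g⁻¹ • q) ≤ 1 ↔ q ⬝ᵥ B *ᵥ q ≤ g ^ 2 := by
  rw [mulVec_smul, smul_dotProduct, dotProduct_smul, smul_eq_mul, smul_eq_mul, ← mul_assoc,
    ← mul_inv, ← sq, inv_mul_le_iff₀ (by positivity), mul_one]

theorem exists_isReference {Q : Matrix (Fin m) (Fin n) ℝ} {g : ℝ} (h : gamma2 Q < g) :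
    ∃ X : Matrix (Fin n) (Fin n) ℝ, IsReference X ∧
      ∀ i, (g⁻¹ • Q i) ⬝ᵥ X⁻¹ *ᵥ (g⁻¹ • Q i) ≤ 1 := by
  obtain ⟨k, L, R, rfl, hLR⟩ := exists_factorization_lt h
  refine ⟨factorReference R, isReference_factorReference R, fun i => ?_⟩
  rw [quadForm_inv_smul_le_one_iff ((gamma2_nonneg _).trans_lt h)]
  exact (factorReference_covers L R i).trans
    (pow_le_pow_left₀ (mul_nonneg (norm2toInf_nonneg L) (norm1to2_nonneg R)) hLR.le 2)

end FactorReference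

section Phases

variable {n : ℕ} {t : ℕ}

open Classical in
/-- The state of the covering procedure for the rows of a matrix, divided by the scale `g`; the
procedure ignores all rows from the moment at which the factorization norm reaches `g`. -/
def phase (g : ℝ) : {t : ℕ} → Matrix (Fin t) (Fin n) ℝ → CoverState (Fin n)
  | 0, _ => CoverState.start (Fin n)
  | t + 1, Q =>
    if gamma2 Q < g then (phase g (firstRows Q t t.le_succ)).absorb (g⁻¹ • Q (Fin.last t))
    else phase g (firstRows Q t t.le_succ)

theorem phase_of_lt {g : ℝ} {Q : Matrix (Fin (t + 1)) (Fin n) ℝ} (h : gamma2 Q < g) :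
    phase g Q = (phase g (firstRows Q t t.le_succ)).absorb (g⁻¹ • Q (Fin.last t)) := by
  rw [phase, if_pos h]

theorem phase_of_le {g : ℝ} {Q : Matrix (Fin (t + 1)) (Fin n) ℝ} (h : g ≤ gamma2 Q) :
    phase g Q = phase g (firstRows Q t t.le_succ) := by
  rw [phase, if_neg h.not_gt]

theorem inv_phase {g : ℝ} {X : Matrix (Fin n) (Fin n) ℝ} (hX : IsReference X) :
    ∀ {t : ℕ} (Q : Matrix (Fin t) (Fin n) ℝ), gamma2 Q < g →
      (∀ i, (g⁻¹ • Q i) ⬝ᵥ X⁻¹ *ᵥ (g⁻¹ • Q i) ≤ 1) → CoverState.Inv X (phase g Q)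
  | 0, _, _, _ => CoverState.inv_start hX
  | t + 1, Q, hQ, hcover => by
    rw [phase_of_lt hQ]
    exact (inv_phase hX _ ((gamma2_firstRows_le Q t t.le_succ).trans_lt hQ) fun i =>
      hcover _).absorb hX (hcover _)

theorem exists_inv_phase_firstRows {g : ℝ} {Q : Matrix (Fin (t + 1)) (Fin n) ℝ}
    (hQ : gamma2 Q < g) : ∃ X, IsReference X ∧
      (g⁻¹ • Q (Fin.last t)) ⬝ᵥ X⁻¹ *ᵥ (g⁻¹ • Q (Fin.last t)) ≤ 1 ∧
      CoverState.Inv X (phase g (firstRows Q t t.le_succ)) := by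
  obtain ⟨X, hX, hcover⟩ := exists_isReference hQ
  exact ⟨X, hX, hcover _, inv_phase hX _ ((gamma2_firstRows_le Q t t.le_succ).trans_lt hQ)
    fun i => hcover _⟩

theorem exists_inv_phase (g : ℝ) : ∀ {t : ℕ} (Q : Matrix (Fin t) (Fin n) ℝ),
    ∃ X, IsReference X ∧ CoverState.Inv X (phase g Q)
  | 0, _ => by
    have hone : IsReference (1 : Matrix (Fin n) (Fin n) ℝ) :=
      ⟨le_rfl, fun i => (one_apply_eq i).trans_le one_le_two⟩
    exact ⟨1, hone, CoverState.inv_start hone⟩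
  | t + 1, Q => by
    rcases lt_or_ge (gamma2 Q) g with hQ | hQ
    · obtain ⟨X, hX, hcover, hinv⟩ := exists_inv_phase_firstRows hQ
      exact ⟨X, hX, phase_of_lt hQ ▸ hinv.absorb hX hcover⟩
    · rw [phase_of_le hQ]
      exact exists_inv_phase g _

theorem phase_posDef (g : ℝ) (Q : Matrix (Fin t) (Fin n) ℝ) : (phase g Q).S.PosDef :=
  let ⟨_, _, hinv⟩ := exists_inv_phase g Q
  hinv.posDef_S

theorem diag_phase_le (g : ℝ) (Q : Matrix (Fin t) (Fin n) ℝ) (i : Fin n) :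
    (phase g Q).S i i ≤ 24 * (1 + Real.log n) := by
  obtain ⟨X, hX, hinv⟩ := exists_inv_phase g Q
  simpa only [Fintype.card_fin] using hinv.diag_S_le hX i

theorem phase_firstRows_le (g : ℝ) (Q : Matrix (Fin (t + 1)) (Fin n) ℝ) :
    (phase g (firstRows Q t t.le_succ)).S ≤ (phase g Q).S := by
  rcases lt_or_ge (gamma2 Q) g with hQ | hQ
  · obtain ⟨X, hX, hcover, hinv⟩ := exists_inv_phase_firstRows hQ
    rw [phase_of_lt hQ]
    exact hinv.le_absorb_S hX hcover
  · rw [phase_of_le hQ]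

theorem phase_covers {g : ℝ} {Q : Matrix (Fin (t + 1)) (Fin n) ℝ} (hQ : gamma2 Q < g) :
    Q (Fin.last t) ⬝ᵥ (phase g Q).S⁻¹ *ᵥ Q (Fin.last t) ≤ g ^ 2 := by
  obtain ⟨X, hX, hcover, hinv⟩ := exists_inv_phase_firstRows hQ
  rw [← quadForm_inv_smul_le_one_iff ((gamma2_nonneg Q).trans_lt hQ), phase_of_lt hQ]
  exact hinv.absorb_covers hX hcover

end Phases

section FirstNorm

variable {n : ℕ} {t : ℕ}

/-- The sup norm of the first nonzero row, or `0` if all rows vanish; it is the unit of the scales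
at which the covering procedure runs. -/
def firstNorm : {t : ℕ} → Matrix (Fin t) (Fin n) ℝ → ℝ
  | 0, _ => 0
  | t + 1, Q =>
    if firstNorm (firstRows Q t t.le_succ) = 0 then ‖Q (Fin.last t)‖
    else firstNorm (firstRows Q t t.le_succ)

theorem firstNorm_succ_of_eq {Q : Matrix (Fin (t + 1)) (Fin n) ℝ}
    (h : firstNorm (firstRows Q t t.le_succ) = 0) : firstNorm Q = ‖Q (Fin.last t)‖ := by
  rw [firstNorm, if_pos h]

theorem firstNorm_succ_of_ne {Q : Matrix (Fin (t + 1)) (Fin n) ℝ}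
    (h : firstNorm (firstRows Q t t.le_succ) ≠ 0) :
    firstNorm Q = firstNorm (firstRows Q t t.le_succ) := by
  rw [firstNorm, if_neg h]

theorem firstNorm_nonneg : ∀ {t : ℕ} (Q : Matrix (Fin t) (Fin n) ℝ), 0 ≤ firstNorm Q
  | 0, _ => le_rfl
  | t + 1, Q => by
    rw [firstNorm]
    split_ifs
    · exact norm_nonneg _
    · exact firstNorm_nonneg _

theorem firstNorm_pos {Q : Matrix (Fin t) (Fin n) ℝ} (h : firstNorm Q ≠ 0) : 0 < firstNorm Q :=
  (firstNorm_nonneg Q).lt_of_ne' h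

theorem firstNorm_le_gamma2 : ∀ {t : ℕ} (Q : Matrix (Fin t) (Fin n) ℝ), firstNorm Q ≤ gamma2 Q
  | 0, Q => gamma2_nonneg Q
  | t + 1, Q => by
    rw [firstNorm]
    split_ifs
    · exact norm_row_le_gamma2 _ _
    · exact (firstNorm_le_gamma2 _).trans (gamma2_firstRows_le _ _ _)

theorem last_eq_zero_of_firstNorm_eq_zero {Q : Matrix (Fin (t + 1)) (Fin n) ℝ}
    (h : firstNorm Q = 0) : Q (Fin.last t) = 0 := by
  rw [firstNorm] at h
  split_ifs at h with hinit
  · exact norm_eq_zero.1 h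
  · exact absurd h hinit

theorem firstNorm_eq_zero : ∀ {t : ℕ} {Q : Matrix (Fin t) (Fin n) ℝ}, (∀ i, Q i = 0) →
    firstNorm Q = 0
  | 0, _, _ => rfl
  | t + 1, Q, h => by
    rw [firstNorm_succ_of_eq (firstNorm_eq_zero fun i => h _)]
    exact norm_eq_zero.2 (h _)

theorem firstNorm_firstRows {m : ℕ} (Q : Matrix (Fin m) (Fin n) ℝ) (s : Fin m)
    (hzero : ∀ i, i < s → Q i = 0) (hs : Q s ≠ 0) (t : ℕ) (hst : s < t) (ht : t ≤ m) :
    firstNorm (firstRows Q t ht) = ‖Q s‖ := by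
  induction t with
  | zero => omega
  | succ t ih =>
    rcases (Nat.lt_succ_iff.1 hst).eq_or_lt with heq | hlt
    · have hinit : firstNorm (firstRows (firstRows Q (t + 1) ht) t t.le_succ) = 0 :=
        firstNorm_eq_zero fun i => hzero _ (Fin.lt_def.2 (i.isLt.trans_eq heq.symm))
      rw [firstNorm_succ_of_eq hinit]
      exact congrArg (fun i => ‖Q i‖) (Fin.ext heq.symm)
    · have hinit : firstNorm (firstRows (firstRows Q (t + 1) ht) t t.le_succ) = ‖Q s‖ :=
        ih hlt (by omega)
      rw [firstNorm_succ_of_ne (hinit.trans_ne (norm_ne_zero_iff.2 hs)), hinit]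

end FirstNorm

section Level

variable {n : ℕ} {t : ℕ} {Q : Matrix (Fin t) (Fin n) ℝ}

/-- The index of the scale `2 ^ level Q * firstNorm Q` in use for `Q`, chosen so that this scale
lies strictly above `gamma2 Q` and is at most `4 * gamma2 Q`. -/
def level (Q : Matrix (Fin t) (Fin n) ℝ) : ℕ :=
  ⌈Real.logb 2 (gamma2 Q / firstNorm Q)⌉₊ + 1

theorem one_le_gamma2_div_firstNorm (h : firstNorm Q ≠ 0) : 1 ≤ gamma2 Q / firstNorm Q :=
  (one_le_div (firstNorm_pos h)).2 (firstNorm_le_gamma2 Q)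

theorem gamma2_lt_scale (h : firstNorm Q ≠ 0) : gamma2 Q < 2 ^ level Q * firstNorm Q := by
  have hratio := one_le_gamma2_div_firstNorm h
  rw [← div_lt_iff₀ (firstNorm_pos h), ← Real.rpow_natCast,
    ← Real.logb_lt_iff_lt_rpow one_lt_two (by linarith), level]
  push_cast
  linarith [Nat.le_ceil (Real.logb 2 (gamma2 Q / firstNorm Q))]

theorem level_lt (h : firstNorm Q ≠ 0) :
    (level Q : ℝ) < Real.logb 2 (gamma2 Q / firstNorm Q) + 2 := by
  have hceil := Nat.ceil_lt_add_one
    (Real.logb_nonneg one_lt_two (one_le_gamma2_div_firstNorm h))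
  rw [level]
  push_cast
  linarith

theorem scale_le (h : firstNorm Q ≠ 0) : 2 ^ level Q * firstNorm Q ≤ 4 * gamma2 Q := by
  have hratio := one_le_gamma2_div_firstNorm h
  rw [← le_div_iff₀ (firstNorm_pos h), mul_div_assoc, ← Real.rpow_natCast]
  calc (2 : ℝ) ^ (level Q : ℝ)
      ≤ 2 ^ (Real.logb 2 (gamma2 Q / firstNorm Q) + 2) :=
        Real.rpow_le_rpow_of_exponent_le one_le_two (level_lt h).le
    _ = 4 * (gamma2 Q / firstNorm Q) := by
        rw [Real.rpow_add two_pos, Real.rpow_logb two_pos (by norm_num) (by linarith), mul_comm]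
        norm_num

theorem sq_scale_le (h : firstNorm Q ≠ 0) :
    (2 ^ level Q * firstNorm Q) ^ 2 ≤ (4 * gamma2 Q) ^ 2 :=
  pow_le_pow_left₀ (mul_nonneg (by positivity) (firstNorm_nonneg Q)) (scale_le h) 2

theorem level_add_one_le (h : firstNorm Q ≠ 0) :
    (level Q : ℝ) + 1 ≤ 3 * (1 + Real.log (gamma2 Q / firstNorm Q)) := by
  have hlog := Real.log_nonneg (one_le_gamma2_div_firstNorm h)
  have hlogb : Real.logb 2 (gamma2 Q / firstNorm Q) ≤ 3 * Real.log (gamma2 Q / firstNorm Q) := by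
    rw [Real.logb, div_le_iff₀ (Real.log_pos one_lt_two)]
    nlinarith [Real.log_two_gt_d9]
  linarith [level_lt h]

theorem level_firstRows_le {Q : Matrix (Fin (t + 1)) (Fin n) ℝ}
    (h : firstNorm (firstRows Q t t.le_succ) ≠ 0) :
    level (firstRows Q t t.le_succ) ≤ level Q := by
  have hratio := one_le_gamma2_div_firstNorm h
  rw [level, level, firstNorm_succ_of_ne h]
  gcongr
  · exact one_lt_two
  · exact firstNorm_nonneg _
  · exact gamma2_firstRows_le Q t t.le_succ

end Level

section TotalCover

variable {n : ℕ} {t : ℕ} {ω : ℝ → ℕ → ℝ}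

/-- The weighted sum of the covering matrices of all scales used so far. The weights may depend on
`firstNorm Q`, which is known from the first nonzero arrival on. -/
def totalCover (ω : ℝ → ℕ → ℝ) (Q : Matrix (Fin t) (Fin n) ℝ) : Matrix (Fin n) (Fin n) ℝ :=
  if firstNorm Q = 0 then 0
  else ∑ j ∈ Finset.range (level Q + 1),
    ω (firstNorm Q) j • (phase (2 ^ j * firstNorm Q) Q).S

theorem totalCover_of_eq {Q : Matrix (Fin t) (Fin n) ℝ} (h : firstNorm Q = 0) :
    totalCover ω Q = 0 := if_pos h

theorem totalCover_of_ne {Q : Matrix (Fin t) (Fin n) ℝ} (h : firstNorm Q ≠ 0) :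
    totalCover ω Q = ∑ j ∈ Finset.range (level Q + 1),
      ω (firstNorm Q) j • (phase (2 ^ j * firstNorm Q) Q).S := if_neg h

theorem smul_phase_posDef (hω : ∀ β j, 0 < β → 0 < ω β j) {β : ℝ} (hβ : 0 < β) (j : ℕ)
    (Q : Matrix (Fin t) (Fin n) ℝ) : (ω β j • (phase (2 ^ j * β) Q).S).PosDef :=
  (phase_posDef _ Q).smul (hω β j hβ)

theorem totalCover_nonneg (hω : ∀ β j, 0 < β → 0 < ω β j) (Q : Matrix (Fin t) (Fin n) ℝ) :
    0 ≤ totalCover ω Q := by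
  rw [totalCover]
  split_ifs with h
  · exact le_rfl
  · exact Finset.sum_nonneg fun j _ =>
      (smul_phase_posDef hω (firstNorm_pos h) j Q).posSemidef.nonneg

theorem smul_phase_le_totalCover (hω : ∀ β j, 0 < β → 0 < ω β j)
    {Q : Matrix (Fin t) (Fin n) ℝ} (h : firstNorm Q ≠ 0) :
    ω (firstNorm Q) (level Q) • (phase (2 ^ level Q * firstNorm Q) Q).S ≤ totalCover ω Q := by
  rw [totalCover_of_ne h]
  exact Finset.single_le_sum
    (f := fun j => ω (firstNorm Q) j • (phase (2 ^ j * firstNorm Q) Q).S)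
    (fun j _ => (smul_phase_posDef hω (firstNorm_pos h) j Q).posSemidef.nonneg)
    (Finset.self_mem_range_succ _)

theorem totalCover_posDef (hω : ∀ β j, 0 < β → 0 < ω β j) {Q : Matrix (Fin t) (Fin n) ℝ}
    (h : firstNorm Q ≠ 0) : (totalCover ω Q).PosDef :=
  posDef_of_le (smul_phase_posDef hω (firstNorm_pos h) _ Q) (smul_phase_le_totalCover hω h)

theorem totalCover_firstRows_le (hω : ∀ β j, 0 < β → 0 < ω β j)
    (Q : Matrix (Fin (t + 1)) (Fin n) ℝ) :
    totalCover ω (firstRows Q t t.le_succ) ≤ totalCover ω Q := by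
  by_cases h : firstNorm (firstRows Q t t.le_succ) = 0
  · rw [totalCover_of_eq h]
    exact totalCover_nonneg hω Q
  · have hsucc := firstNorm_succ_of_ne h
    have hpos := firstNorm_pos h
    rw [totalCover_of_ne h, totalCover_of_ne (hsucc.trans_ne h), hsucc]
    refine (Finset.sum_le_sum fun j _ =>
      smul_le_smul_of_nonneg_left (phase_firstRows_le _ Q) (hω _ j hpos).le).trans ?_
    refine Finset.sum_le_sum_of_subset_of_nonneg ?_ fun j _ _ =>
      (smul_phase_posDef hω hpos j Q).posSemidef.nonneg
    exact Finset.range_mono (Nat.add_le_add_right (level_firstRows_le h) 1)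

theorem diag_totalCover_le (hω : ∀ β j, 0 < β → 0 < ω β j) {Q : Matrix (Fin t) (Fin n) ℝ}
    (h : firstNorm Q ≠ 0) (i : Fin n) : totalCover ω Q i i ≤
      (∑ j ∈ Finset.range (level Q + 1), ω (firstNorm Q) j) * (24 * (1 + Real.log n)) := by
  rw [totalCover_of_ne h, Matrix.sum_apply, Finset.sum_mul]
  exact Finset.sum_le_sum fun j _ =>
    mul_le_mul_of_nonneg_left (diag_phase_le _ Q i) (hω _ j (firstNorm_pos h)).le

theorem totalCover_covers (hω : ∀ β j, 0 < β → 0 < ω β j)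
    {Q : Matrix (Fin (t + 1)) (Fin n) ℝ} (h : firstNorm Q ≠ 0) :
    Q (Fin.last t) ⬝ᵥ (totalCover ω Q)⁻¹ *ᵥ Q (Fin.last t) ≤
      (2 ^ level Q * firstNorm Q) ^ 2 / ω (firstNorm Q) (level Q) := by
  have hpos := hω _ (level Q) (firstNorm_pos h)
  refine (inv_quadForm_anti (smul_phase_posDef hω (firstNorm_pos h) _ Q)
    (smul_phase_le_totalCover hω h) (Q (Fin.last t))).trans ?_
  rw [inv_smul_of_posDef (phase_posDef _ Q) hpos.ne', smul_mulVec, dotProduct_smul, smul_eq_mul,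
    div_eq_inv_mul]
  exact mul_le_mul_of_nonneg_left (phase_covers (gamma2_lt_scale h)) (inv_pos.2 hpos).le

end TotalCover

/-- A family of positive semidefinite matrices, indexed by the histories of arrivals, that grows in
the Loewner order and stays definite on every nonzero arrival; its factors are the matrices that an
online factorization algorithm maintains. -/
structure OnlineCover (n : ℕ) where
  S : {t : ℕ} → Matrix (Fin t) (Fin n) ℝ → Matrix (Fin n) (Fin n) ℝ
  S_zero : ∀ Q : Matrix (Fin 0) (Fin n) ℝ, S Q = 0
  mono : ∀ {t : ℕ} (Q : Matrix (Fin (t + 1)) (Fin n) ℝ), S (firstRows Q t t.le_succ) ≤ S Q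
  posDef_or : ∀ {t : ℕ} (Q : Matrix (Fin (t + 1)) (Fin n) ℝ),
    (S Q).PosDef ∨ Q (Fin.last t) = 0

namespace OnlineCover

variable {n : ℕ} (C : OnlineCover n) {t : ℕ}

/-- A factor `F` of the covering matrix `S = Fᵀ F`: each arrival appends a square root of the
increment of `S`. -/
def factor : {t : ℕ} → Matrix (Fin t) (Fin n) ℝ → Matrix (Fin (n * t)) (Fin n) ℝ
  | 0, _ => 0
  | t + 1, Q => Fin.append (α := Fin n → ℝ) (factor (firstRows Q t t.le_succ))
      (CFC.sqrt (C.S Q - C.S (firstRows Q t t.le_succ)) : Matrix (Fin n) (Fin n) ℝ)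

theorem factor_castAdd (Q : Matrix (Fin (t + 1)) (Fin n) ℝ) (i : Fin (n * t)) :
    C.factor Q (Fin.castAdd n i) = C.factor (firstRows Q t t.le_succ) i :=
  Fin.append_left (α := Fin n → ℝ) _ _ i

theorem factor_natAdd (Q : Matrix (Fin (t + 1)) (Fin n) ℝ) (i : Fin n) :
    C.factor Q (Fin.natAdd (n * t) i) =
      CFC.sqrt (C.S Q - C.S (firstRows Q t t.le_succ)) i :=
  Fin.append_right (α := Fin n → ℝ) _ _ i

theorem transpose_sqrt_mul_sqrt (Q : Matrix (Fin (t + 1)) (Fin n) ℝ) :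
    (CFC.sqrt (C.S Q - C.S (firstRows Q t t.le_succ)))ᵀ *
        CFC.sqrt (C.S Q - C.S (firstRows Q t t.le_succ)) =
      C.S Q - C.S (firstRows Q t t.le_succ) := by
  rw [← conjTranspose_eq_transpose_of_trivial,
    (CFC.sqrt_nonneg _).posSemidef.isHermitian.eq]
  exact CFC.sqrt_mul_sqrt_self _ (sub_nonneg.2 (C.mono Q))

theorem factor_transpose_mul_succ (Q : Matrix (Fin (t + 1)) (Fin n) ℝ) :
    (C.factor Q)ᵀ * C.factor Q =
      (C.factor (firstRows Q t t.le_succ))ᵀ * C.factor (firstRows Q t t.le_succ) +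
        (C.S Q - C.S (firstRows Q t t.le_succ)) := by
  rw [← C.transpose_sqrt_mul_sqrt Q]
  ext a b
  simp only [Matrix.add_apply, mul_apply, transpose_apply]
  refine (Fin.sum_univ_add (a := n * t) (b := n)
    (fun i => C.factor Q i a * C.factor Q i b)).trans ?_
  simp only [factor_castAdd, factor_natAdd]

theorem factor_transpose_mul : ∀ {t : ℕ} (Q : Matrix (Fin t) (Fin n) ℝ),
    (C.factor Q)ᵀ * C.factor Q = C.S Q
  | 0, Q => by rw [C.S_zero, factor, Matrix.mul_zero]
  | t + 1, Q => by
    rw [factor_transpose_mul_succ, factor_transpose_mul (firstRows Q t t.le_succ), add_sub_cancel]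

/-- The coefficients of the last arrival with respect to the rows of the factor; they are the
solution of least Euclidean norm. -/
def coeff (Q : Matrix (Fin (t + 1)) (Fin n) ℝ) : Fin (n * (t + 1)) → ℝ :=
  C.factor Q *ᵥ ((C.S Q)⁻¹ *ᵥ Q (Fin.last t))

theorem transpose_mulVec_coeff (Q : Matrix (Fin (t + 1)) (Fin n) ℝ) :
    (C.factor Q)ᵀ *ᵥ C.coeff Q = Q (Fin.last t) := by
  rw [coeff, mulVec_mulVec, factor_transpose_mul]
  rcases C.posDef_or Q with hpos | hzero
  · exact mulVec_inv_mulVec hpos _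
  · rw [hzero, mulVec_zero, mulVec_zero]

theorem coeff_dotProduct_self (Q : Matrix (Fin (t + 1)) (Fin n) ℝ) :
    C.coeff Q ⬝ᵥ C.coeff Q = Q (Fin.last t) ⬝ᵥ (C.S Q)⁻¹ *ᵥ Q (Fin.last t) :=
  calc C.coeff Q ⬝ᵥ C.coeff Q
      = C.coeff Q ⬝ᵥ C.factor Q *ᵥ ((C.S Q)⁻¹ *ᵥ Q (Fin.last t)) := rfl
    _ = Q (Fin.last t) ⬝ᵥ (C.S Q)⁻¹ *ᵥ Q (Fin.last t) := by
      rw [dotProduct_mulVec, ← mulVec_transpose, transpose_mulVec_coeff]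

theorem l2norm_coeff_le {γ : ℝ} (hγ : 0 ≤ γ) {Q : Matrix (Fin (t + 1)) (Fin n) ℝ}
    (h : Q (Fin.last t) ⬝ᵥ (C.S Q)⁻¹ *ᵥ Q (Fin.last t) ≤ γ ^ 2) : l2norm (C.coeff Q) ≤ γ :=
  l2norm_le hγ ((C.coeff_dotProduct_self Q).trans_le h)

theorem l2norm_coeff_of_eq_zero {Q : Matrix (Fin (t + 1)) (Fin n) ℝ}
    (h : Q (Fin.last t) = 0) : l2norm (C.coeff Q) = 0 := by
  refine le_antisymm (C.l2norm_coeff_le le_rfl ?_) (l2norm_nonneg _)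
  rw [h, zero_dotProduct, sq, mul_zero]

/-- The row arrival algorithm whose right matrices are the factors of a cover with small
diagonal. -/
def rowAlgorithm (hC : ∀ {t : ℕ} (Q : Matrix (Fin t) (Fin n) ℝ) (i : Fin n), C.S Q i i ≤ 1) :
    RowArrivalAlgorithm n where
  k {t} _ := n * t
  R Q := C.factor Q
  ell Q := C.coeff Q
  k_mono {t} _ := Nat.mul_le_mul_left n t.le_succ
  R_extends Q i := C.factor_castAdd Q i
  ell_mul_R Q := by rw [← mulVec_transpose, transpose_mulVec_coeff]
  norm_R_le Q := norm1to2_le zero_le_one fun j => by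
    rw [factor_transpose_mul, one_pow]
    exact hC Q j

/-- The column arrival algorithm whose left matrices are the transposed factors of a cover for
which all arrivals have short coefficient vectors. -/
def columnAlgorithm (hC : ∀ {t : ℕ} (Q : Matrix (Fin (t + 1)) (Fin n) ℝ),
    Q (Fin.last t) ⬝ᵥ (C.S Q)⁻¹ *ᵥ Q (Fin.last t) ≤ 1) : ColumnArrivalAlgorithm n where
  k {t} _ := n * t
  L A := (C.factor Aᵀ)ᵀ
  r A := C.coeff Aᵀ
  k_mono {t} _ := Nat.mul_le_mul_left n t.le_succ
  L_extends A i j := congrFun (C.factor_castAdd Aᵀ j) i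
  L_mul_r A := C.transpose_mulVec_coeff Aᵀ
  norm_r_le A := C.l2norm_coeff_le zero_le_one ((hC Aᵀ).trans_eq (one_pow 2).symm)

end OnlineCover

/-- The cover that combines the covering matrices of all scales with the weights `ω`. -/
def scaleCover (n : ℕ) (ω : ℝ → ℕ → ℝ) (hω : ∀ β j, 0 < β → 0 < ω β j) : OnlineCover n where
  S Q := totalCover ω Q
  S_zero _ := totalCover_of_eq rfl
  mono Q := totalCover_firstRows_le hω Q
  posDef_or Q := by
    by_cases h : firstNorm Q = 0
    · exact .inr (last_eq_zero_of_firstNorm_eq_zero h)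
    · exact .inl (totalCover_posDef hω h)

theorem one_le_one_add_log (n : ℕ) : 1 ≤ 1 + Real.log n :=
  le_add_of_nonneg_right (Real.log_natCast_nonneg n)

section ColumnArrival

variable {m : ℕ}

/-- The weight of the scale `2 ^ j * β` in the column arrival algorithm: it gives the arrivals
during that scale coefficient vectors of length at most `1`. -/
def columnWeight (β : ℝ) (j : ℕ) : ℝ := (2 ^ j * β) ^ 2

theorem columnWeight_pos (β : ℝ) (j : ℕ) (hβ : 0 < β) : 0 < columnWeight β j := by
  rw [columnWeight]
  positivity

theorem sum_columnWeight_le (β : ℝ) (J : ℕ) :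
    ∑ j ∈ Finset.range (J + 1), columnWeight β j ≤ 4 / 3 * (2 ^ J * β) ^ 2 := by
  induction J with
  | zero =>
    rw [zero_add, Finset.sum_range_one, columnWeight]
    linarith [sq_nonneg (2 ^ 0 * β)]
  | succ J ih =>
    have hquadruple : (2 ^ (J + 1) * β) ^ 2 = 4 * (2 ^ J * β) ^ 2 := by ring
    rw [Finset.sum_range_succ, columnWeight, hquadruple]
    linarith

theorem columnCover_covers {t : ℕ} (Q : Matrix (Fin (t + 1)) (Fin m) ℝ) :
    Q (Fin.last t) ⬝ᵥ (totalCover columnWeight Q)⁻¹ *ᵥ Q (Fin.last t) ≤ 1 := by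
  by_cases h : firstNorm Q = 0
  · rw [last_eq_zero_of_firstNorm_eq_zero h, zero_dotProduct]
    exact zero_le_one
  · exact (totalCover_covers columnWeight_pos h).trans (div_self_le_one _)

theorem diag_columnCover_le {t : ℕ} (Q : Matrix (Fin t) (Fin m) ℝ) (i : Fin m) :
    totalCover columnWeight Q i i ≤ (23 * (gamma2 Q * √(1 + Real.log m))) ^ 2 := by
  have hlog : 0 ≤ 1 + Real.log m := zero_le_one.trans (one_le_one_add_log m)
  by_cases h : firstNorm Q = 0
  · rw [totalCover_of_eq h, Matrix.zero_apply]
    positivity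
  · calc totalCover columnWeight Q i i
        ≤ (∑ j ∈ Finset.range (level Q + 1), columnWeight (firstNorm Q) j) *
            (24 * (1 + Real.log m)) := diag_totalCover_le columnWeight_pos h i
      _ ≤ (4 / 3 * (4 * gamma2 Q) ^ 2) * (24 * (1 + Real.log m)) := by
          gcongr
          linarith [sum_columnWeight_le (firstNorm Q) (level Q), sq_scale_le h]
      _ = 512 * (gamma2 Q ^ 2 * (1 + Real.log m)) := by ring
      _ ≤ 529 * (gamma2 Q ^ 2 * (1 + Real.log m)) := by gcongr; norm_num
      _ = (23 * (gamma2 Q * √(1 + Real.log m))) ^ 2 := by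
          rw [mul_pow, mul_pow, Real.sq_sqrt hlog]
          norm_num

variable (m) in
/-- The column arrival algorithm of the cover with weights `columnWeight`. -/
def onlineColumnFactorization : ColumnArrivalAlgorithm m :=
  (scaleCover m columnWeight columnWeight_pos).columnAlgorithm columnCover_covers

theorem onlineColumnFactorization_achievesValue {N : ℕ} (A : Matrix (Fin m) (Fin N) ℝ) :
    (onlineColumnFactorization m).AchievesValue A (23 * (gamma2 A * √(1 + Real.log m))) := by
  have hγ := gamma2_nonneg A
  set F := (scaleCover m columnWeight columnWeight_pos).factor Aᵀ
  change norm2toInf Fᵀ ≤ _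
  rw [norm2toInf_transpose]
  refine norm1to2_le (by positivity) fun i => ?_
  rw [OnlineCover.factor_transpose_mul, ← gamma2_transpose]
  exact diag_columnCover_le Aᵀ i

end ColumnArrival

section RowArrival

variable {c : ℝ} {N : ℕ}

/-- The sum `∑ (j + 1) ^ (-(1 + 2 c))` that normalizes the weights of the row arrival
algorithm. -/
def rowWeightSum (c : ℝ) : ℝ := ∑' j : ℕ, 1 / ((j : ℝ) + 1) ^ (1 + 2 * c)

/-- The weight of the scale with index `j` in the row arrival algorithm; the total weight is such
that the diagonal of the cover stays below `1`. -/
def rowWeight (c : ℝ) (N j : ℕ) : ℝ :=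
  1 / ((j : ℝ) + 1) ^ (1 + 2 * c) / (rowWeightSum c * (24 * (1 + Real.log N)))

theorem summable_one_div_add_one_rpow (hc : 0 < c) :
    Summable fun j : ℕ => 1 / ((j : ℝ) + 1) ^ (1 + 2 * c) := by
  simpa only [Nat.cast_add, Nat.cast_one] using (summable_nat_add_iff 1).2
    (Real.summable_one_div_nat_rpow.2 (by linarith : 1 < 1 + 2 * c))

theorem rowWeightSum_pos (hc : 0 < c) : 0 < rowWeightSum c :=
  (summable_one_div_add_one_rpow hc).tsum_pos (fun j => by positivity) 0 (by positivity)

theorem rowWeight_pos (hc : 0 < c) (N j : ℕ) : 0 < rowWeight c N j := by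
  have hsum := rowWeightSum_pos hc
  rw [rowWeight]
  positivity

theorem sum_rowWeight_mul_le (hc : 0 < c) (N J : ℕ) :
    (∑ j ∈ Finset.range J, rowWeight c N j) * (24 * (1 + Real.log N)) ≤ 1 := by
  have hsum := rowWeightSum_pos hc
  have hle : ∑ j ∈ Finset.range J, 1 / ((j : ℝ) + 1) ^ (1 + 2 * c) ≤ rowWeightSum c :=
    (summable_one_div_add_one_rpow hc).sum_le_tsum _ fun j _ => by positivity
  simp only [rowWeight]
  rw [← Finset.sum_div, div_mul_eq_mul_div, div_le_one (by positivity)]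
  gcongr

/-- The cover of the row arrival algorithm. -/
def rowCover (hc : 0 < c) (N : ℕ) : OnlineCover N :=
  scaleCover N (fun _ => rowWeight c N) fun _ j _ => rowWeight_pos hc N j

theorem diag_rowCover_le (hc : 0 < c) {t : ℕ} (Q : Matrix (Fin t) (Fin N) ℝ) (i : Fin N) :
    (rowCover hc N).S Q i i ≤ 1 := by
  by_cases h : firstNorm Q = 0
  · change totalCover (fun _ => rowWeight c N) Q i i ≤ 1
    rw [totalCover_of_eq h, Matrix.zero_apply]
    exact zero_le_one
  · exact (diag_totalCover_le (fun _ j _ => rowWeight_pos hc N j) h i).trans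
      (sum_rowWeight_mul_le hc N _)

/-- The value achieved by the row arrival algorithm on a matrix of factorization norm `γ` with
first nonzero row of sup norm `β`. -/
def rowValue (c : ℝ) (N : ℕ) (β γ : ℝ) : ℝ :=
  4 * √(24 * rowWeightSum c) * 3 ^ (1 / 2 + c) *
    (γ * (1 + Real.log (γ / β)) ^ (1 / 2 + c) * √(1 + Real.log N))

theorem rowValue_nonneg (N : ℕ) {β γ : ℝ} (hβ : 0 < β) (hγ : β ≤ γ) :
    0 ≤ rowValue c N β γ := by
  have hpos : 0 < γ := hβ.trans_le hγ
  have hlog := Real.log_nonneg ((one_le_div hβ).2 hγ)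
  rw [rowValue]
  positivity

theorem rowValue_mono (hc : 0 < c) (N : ℕ) {β γ γ' : ℝ} (hβ : 0 < β) (hγ : β ≤ γ)
    (h : γ ≤ γ') : rowValue c N β γ ≤ rowValue c N β γ' := by
  have hpos : 0 < γ := hβ.trans_le hγ
  have hpos' : 0 < γ' := hpos.trans_le h
  have hlog := Real.log_nonneg ((one_le_div hβ).2 hγ)
  rw [rowValue, rowValue]
  gcongr

theorem sq_rowValue (hc : 0 < c) (N : ℕ) {β γ : ℝ} (hβ : 0 < β) (hγ : β ≤ γ) :
    rowValue c N β γ ^ 2 = (4 * γ) ^ 2 * (24 * rowWeightSum c) *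
      (3 * (1 + Real.log (γ / β))) ^ (1 + 2 * c) * (1 + Real.log N) := by
  have hsum := rowWeightSum_pos hc
  have hlog := one_le_one_add_log N
  have hlogγ := Real.log_nonneg ((one_le_div hβ).2 hγ)
  have hrpow : (3 * (1 + Real.log (γ / β))) ^ (1 + 2 * c) =
      (3 ^ (1 / 2 + c) * (1 + Real.log (γ / β)) ^ (1 / 2 + c)) ^ 2 := by
    rw [← Real.mul_rpow (by norm_num) (by linarith), ← Real.rpow_mul_natCast (by linarith)]
    congr 1
    push_cast
    ring
  rw [hrpow, rowValue, ← Real.sq_sqrt (show 0 ≤ 24 * rowWeightSum c by positivity),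
    ← Real.sq_sqrt (show 0 ≤ 1 + Real.log N by linarith)]
  simp only [Real.sqrt_sq (Real.sqrt_nonneg _)]
  ring

theorem l2norm_coeff_rowCover_le (hc : 0 < c) {t : ℕ} {Q : Matrix (Fin (t + 1)) (Fin N) ℝ}
    (h : firstNorm Q ≠ 0) :
    l2norm ((rowCover hc N).coeff Q) ≤ rowValue c N (firstNorm Q) (gamma2 Q) := by
  have hβ := firstNorm_pos h
  have hγ := firstNorm_le_gamma2 Q
  have hsum := rowWeightSum_pos hc
  refine (rowCover hc N).l2norm_coeff_le (rowValue_nonneg N hβ hγ) ?_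
  refine (totalCover_covers (fun _ j _ => rowWeight_pos hc N j) h).trans ?_
  calc (2 ^ level Q * firstNorm Q) ^ 2 / rowWeight c N (level Q)
      = (2 ^ level Q * firstNorm Q) ^ 2 * (24 * rowWeightSum c) *
          ((level Q : ℝ) + 1) ^ (1 + 2 * c) * (1 + Real.log N) := by
        rw [rowWeight]
        field_simp
    _ ≤ (4 * gamma2 Q) ^ 2 * (24 * rowWeightSum c) *
          (3 * (1 + Real.log (gamma2 Q / firstNorm Q))) ^ (1 + 2 * c) * (1 + Real.log N) := by
        gcongr ?_ * _ * ?_ ^ _ * _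
        · exact sq_scale_le h
        · exact level_add_one_le h
    _ = rowValue c N (firstNorm Q) (gamma2 Q) ^ 2 := (sq_rowValue hc N hβ hγ).symm

/-- The row arrival algorithm of the cover with weights `rowWeight`. -/
def onlineRowFactorization (hc : 0 < c) (N : ℕ) : RowArrivalAlgorithm N :=
  (rowCover hc N).rowAlgorithm (diag_rowCover_le hc)

theorem onlineRowFactorization_achievesValue_zero (hc : 0 < c) (m N : ℕ) :
    (onlineRowFactorization hc N).AchievesValue (0 : Matrix (Fin m) (Fin N) ℝ) 0 :=
  fun _ _ => ((rowCover hc N).l2norm_coeff_of_eq_zero rfl).le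

theorem onlineRowFactorization_achievesValue (hc : 0 < c) {m : ℕ} {Q : Matrix (Fin m) (Fin N) ℝ}
    {s : Fin m} (hzero : ∀ i, i < s → Q i = 0) (hs : Q s ≠ 0) :
    (onlineRowFactorization hc N).AchievesValue Q (rowValue c N ‖Q s‖ (gamma2 Q)) := by
  intro t ht
  set P := firstRows Q (t + 1) ht
  change l2norm ((rowCover hc N).coeff P) ≤ _
  rcases lt_or_ge t s with hts | hst
  · rw [(rowCover hc N).l2norm_coeff_of_eq_zero (hzero _ (Fin.lt_def.2 hts))]
    exact rowValue_nonneg N (norm_pos_iff.2 hs) (norm_row_le_gamma2 Q s)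
  · have hfirst : firstNorm P = ‖Q s‖ :=
      firstNorm_firstRows Q s hzero hs (t + 1) (Nat.lt_succ_of_le hst) ht
    have hne : firstNorm P ≠ 0 := hfirst.trans_ne (norm_ne_zero_iff.2 hs)
    rw [← hfirst]
    exact (l2norm_coeff_rowCover_le hc hne).trans
      (rowValue_mono hc N (firstNorm_pos hne) (firstNorm_le_gamma2 P)
        (gamma2_firstRows_le Q _ ht))

end RowArrival

theorem gamma2_mul_rpow_nonneg {m N : ℕ} {Q : Matrix (Fin m) (Fin N) ℝ} {s : Fin m}
    (hs : Q s ≠ 0) (p : ℝ) : 0 ≤ gamma2 Q * (1 + Real.log (gamma2 Q / ‖Q s‖)) ^ p := by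
  have hγ := gamma2_nonneg Q
  have hlog : 0 ≤ Real.log (gamma2 Q / ‖Q s‖) :=
    Real.log_nonneg ((one_le_div (norm_pos_iff.2 hs)).2 (norm_row_le_gamma2 Q s))
  positivity

theorem RowArrivalAlgorithm.AchievesValue.mono {N m : ℕ} {alg : RowArrivalAlgorithm N}
    {Q : Matrix (Fin m) (Fin N) ℝ} {γ γ' : ℝ} (h : alg.AchievesValue Q γ) (hγ : γ ≤ γ') :
    alg.AchievesValue Q γ' :=
  fun t ht => (h t ht).trans hγ

theorem ColumnArrivalAlgorithm.AchievesValue.mono {m N : ℕ} {alg : ColumnArrivalAlgorithm m}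
    {A : Matrix (Fin m) (Fin N) ℝ} {γ γ' : ℝ} (h : alg.AchievesValue A γ) (hγ : γ ≤ γ') :
    alg.AchievesValue A γ' :=
  h.trans hγ

theorem mul_sqrt_one_add_log_le {K x : ℝ} (hK : 0 ≤ K) (hx : 0 ≤ x) (n : ℕ) :
    K * (x * √(1 + Real.log n)) ≤ K * (x * (1 + Real.log n) ^ 3) := by
  have hlog := one_le_one_add_log n
  gcongr
  calc √(1 + Real.log n) ≤ 1 + Real.log n := Real.sqrt_le_self_iff.2 (.inr hlog)
    _ ≤ (1 + Real.log n) ^ 3 := le_self_pow₀ hlog three_ne_zero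

end OnlineFactorization

end

theorem theorem3_general :
    (∀ c : ℝ, 0 < c →
      ∃ K : ℝ, 0 < K ∧ ∃ alg : (N : ℕ) → OnlineFactorization.RowArrivalAlgorithm N,
        ∀ (m N : ℕ) (Q : Matrix (Fin m) (Fin N) ℝ),
          (Q = 0 → (alg N).AchievesValue Q 0) ∧
          ∀ s : Fin m, (∀ i : Fin m, i < s → Q i = 0) → Q s ≠ 0 →
            (alg N).AchievesValue Q
              (K * (OnlineFactorization.gamma2 Q *
                (1 + Real.log (OnlineFactorization.gamma2 Q / ‖Q s‖)) ^ (1 / 2 + c) *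
                √(1 + Real.log N)))) ∧
    (∃ K : ℝ, 0 < K ∧ ∃ alg : (m : ℕ) → OnlineFactorization.ColumnArrivalAlgorithm m,
      ∀ (m N : ℕ) (A : Matrix (Fin m) (Fin N) ℝ),
        (alg m).AchievesValue A
          (K * (OnlineFactorization.gamma2 A * √(1 + Real.log m)))) := by
  refine ⟨fun c hc => ?_, 23, by norm_num, OnlineFactorization.onlineColumnFactorization,
    fun m N A => OnlineFactorization.onlineColumnFactorization_achievesValue A⟩
  have hsum := OnlineFactorization.rowWeightSum_pos hc
  refine ⟨4 * √(24 * OnlineFactorization.rowWeightSum c) * 3 ^ (1 / 2 + c), by positivity,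
    OnlineFactorization.onlineRowFactorization hc, fun m N Q => ⟨?_, fun s hzero hs => ?_⟩⟩
  · rintro rfl
    exact OnlineFactorization.onlineRowFactorization_achievesValue_zero hc m N
  · exact OnlineFactorization.onlineRowFactorization_achievesValue hc hzero hs

theorem theorem3 :
    (∀ c : ℝ, 0 < c →
      ∃ K : ℝ, 0 < K ∧ ∃ alg : (N : ℕ) → OnlineFactorization.RowArrivalAlgorithm N,
        ∀ (m N : ℕ) (Q : Matrix (Fin m) (Fin N) ℝ),
          (Q = 0 → (alg N).AchievesValue Q 0) ∧
          ∀ s : Fin m, (∀ i : Fin m, i < s → Q i = 0) → Q s ≠ 0 →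
            (alg N).AchievesValue Q
              (K * (OnlineFactorization.gamma2 Q *
                (1 + Real.log (OnlineFactorization.gamma2 Q / ‖Q s‖)) ^ (1 / 2 + c) *
                (1 + Real.log N) ^ 3))) ∧
    (∃ K : ℝ, 0 < K ∧ ∃ alg : (m : ℕ) → OnlineFactorization.ColumnArrivalAlgorithm m,
      ∀ (m N : ℕ) (A : Matrix (Fin m) (Fin N) ℝ),
        (alg m).AchievesValue A
          (K * (OnlineFactorization.gamma2 A * (1 + Real.log m) ^ 3))) := by
  obtain ⟨hrow, K, hK, columnAlg, hcolumn⟩ := theorem3_general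
  refine ⟨fun c hc => ?_, K, hK, columnAlg, fun m N A => (hcolumn m N A).mono
    (OnlineFactorization.mul_sqrt_one_add_log_le hK.le (OnlineFactorization.gamma2_nonneg A) m)⟩
  obtain ⟨K, hK, rowAlg, hvalue⟩ := hrow c hc
  exact ⟨K, hK, rowAlg, fun m N Q => ⟨(hvalue m N Q).1, fun s hzero hs =>
    ((hvalue m N Q).2 s hzero hs).mono (OnlineFactorization.mul_sqrt_one_add_log_le hK.le
      (OnlineFactorization.gamma2_mul_rpow_nonneg hs _) N)⟩⟩
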